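/- Let $S^3_1=\{x\in\mathbf R^4 : -x_0^2+x_1^2+x_2^2+x_3^2=1\}$ be de Sitter $3$-space with the metric induced from the Lorentzian inner product of signature $(-,+,+,+)$, and let $C_2^m=\{x\in\mathbf R^{m+1} : x_1^2+\dots+x_m^2=x_{m+1}^2\}$ be the standard double cone, whose origin is the double-cone point. A map on an open subset $U$ of $C_2^m$ is called real analytic if it is the restriction of a real analytic map on an open set $\Omega\subset\mathbf R^{m+1}$ with $\Omega\cap C_2^m=U$. An $m$-dimensional DC-manifold is a locally compact, second countable Hausdorff space with an atlas of homeomorphisms from open sets onto connected open subsets of $C_2^m$ with real analytic transition maps; its DC-points are the points sent to the double-cone point by some local DC-coordinate system (compatible chart). A DC-analytic map is a continuous map that is real analytic in such charts. A DC-analytic map $f:X^m\to N^n$ ($n>m$) into a real analytic manifold is a real analytic DC-immersion if for each $p\in X$ there are a local DC-coordinate system $(U,\phi)$ at $p$ and a real analytic diffeomorphism $\Phi$ from a neighbourhood of $f(p)$ containing $f(U)$ onto an open subset of $\mathbf R^n$ with $\Phi\circ f\circ\phi^{-1}(a)=(a,0,\dots,0)$ for all $a\in\phi(U)$. A real analytic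 DC-immersion $f:X^2\to S^3_1$ of a connected $2$-dimensional DC-manifold with set of DC-points $\Sigma$ is called a real analytic space-like CMC-1 DC-immersion if, at each point of $X\setminus\Sigma$, either the metric induced by the immersion $f|_{X\setminus\Sigma}$ is degenerate (a light-like point), or $f$ is near that point a space-like immersion of constant mean curvature $1$ with respect to a suitable continuous unit normal; and the points of the second kind are dense in $X$. A DC-analytic map $f_2$ is an analytic extension of $f_1$ if $f_1=f_2\circ\varphi$ for some DC-analytic map $\varphi$ and the image of $f_1$ is a proper subset of that of $f_2$. (An ordinary real analytic manifold such as $\mathbf R^2$ counts as a DC-manifold without DC-points.) A non-empty set $S\subset N$ is analytically complete if every real analytic $\Gamma:[0,1]\to N$ with $\Gamma([0,\varepsilon))\subset S$ for some $\varepsilon\in(0,1)$ satisfies $\Gamma([0,1])\subset S$. Let $\mathcal X_{SP}=\{(\xi,\eta,t)\in\mathbf R^3 : \xi\eta=t^2/4\}$, with the DC-structure given by the global chart $(\xi,\eta,t)\mapsto(\xi-\eta,\,t,\,\xi+\eta)\in C_2^2$, and let $$\tilde f_{SP}:\mathcal X_{SP}\to S^3_1,\qquad \tilde f_{SP}(\xi,\eta,t)=\tfrac12\big(\xi+\eta,\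 t\cos t-2\sin t,\ t\sin t+2\cos t,\ \xi-\eta\big).$$ Let $f_{SP}:\mathbf R^2\to S^3_1$ be the G-catenoid of type SP, $$f_{SP}(s,t)=\begin{pmatrix}\cosh s&0&0&\sinh s\\0&1&0&0\\0&0&1&0\\ \sinh s&0&0&\cosh s\end{pmatrix}\begin{pmatrix}-\frac t2\\ \frac12t\cos t-\sin t\\ \frac12t\sin t+\cos t\\0\end{pmatrix}.$$ Proposition. The map $\tilde f_{SP}$ is a real analytic space-like CMC-1 DC-immersion. The only DC-point of $\mathcal X_{SP}$ is the origin; near every point with $t\ne0$ the map $\tilde f_{SP}$ is a space-like immersion of constant mean curvature $1$, and every point with $t=0$ other than the origin is a light-like point of $\tilde f_{SP}$. The map $\tilde f_{SP}$ is an analytic extension of $f_{SP}$ and is proper, and its image is analytically complete in $S^3_1$. -/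

import Mathlib

open Set Filter Topology

/-! ### Analytic completeness -/

/-- `N` is a subset of a Euclidean space (an embedded real analytic submanifold) and `S ⊆ N`.
A real analytic map `[0,1] → N` is a map into the ambient space that is real analytic at every
point of `[0,1]` (i.e. on a neighbourhood of `[0,1]`) and takes values in `N` on `[0,1]`. -/
def AnalyticallyComplete {k : ℕ} (N : Set (EuclideanSpace ℝ (Fin k))) (S : Set N) : Prop :=
  S.Nonempty ∧
    ∀ Γ : ℝ → EuclideanSpace ℝ (Fin k), AnalyticOnNhd ℝ Γ (Icc 0 1) →
      (∀ t ∈ Icc (0 : ℝ) 1, Γ t ∈ N) →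
      (∃ ε ∈ Ioo (0 : ℝ) 1, ∀ t ∈ Ico 0 ε, Γ t ∈ Subtype.val '' S) →
      ∀ t ∈ Icc (0 : ℝ) 1, Γ t ∈ Subtype.val '' S

/-! ### Double-cone manifolds -/

/-- The `m`-dimensional standard double cone `x₁² + ⋯ + x_m² = x_{m+1}²` in `ℝ^{m+1}`. -/
def doubleCone (m : ℕ) : Set (EuclideanSpace ℝ (Fin (m + 1))) :=
  {x | ∑ i : Fin m, x i.castSucc ^ 2 = x (Fin.last m) ^ 2}

/-- A map on a subset `U` of the double cone is real analytic if `U` is the trace on the cone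
of an open set `Ω ⊆ ℝ^{m+1}` and the map is the restriction of a real analytic map on `Ω`. -/
def IsConeAnalyticOn {m k : ℕ} (μ : doubleCone m → EuclideanSpace ℝ (Fin k))
    (U : Set (doubleCone m)) : Prop :=
  ∃ Ω : Set (EuclideanSpace ℝ (Fin (m + 1))), IsOpen Ω ∧ Subtype.val ⁻¹' Ω = U ∧
    ∃ g : EuclideanSpace ℝ (Fin (m + 1)) → EuclideanSpace ℝ (Fin k),
      AnalyticOnNhd ℝ g Ω ∧ ∀ x ∈ U, g x = μ x

/-- An `m`-dimensional real analytic double-cone manifold (DC-manifold). -/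
class DCManifold (m : ℕ) (X : Type*) [TopologicalSpace X] where
  locallyCompact : LocallyCompactSpace X
  t2 : T2Space X
  secondCountable : SecondCountableTopology X
  /-- the DC-structure: a family of homeomorphisms between open sets of `X` and of the cone -/
  dcAtlas : Set (OpenPartialHomeomorph X (doubleCone m))
  cover : ∀ x : X, ∃ e ∈ dcAtlas, x ∈ e.source
  connected : ∀ e ∈ dcAtlas, IsConnected e.target
  transition : ∀ e ∈ dcAtlas, ∀ e' ∈ dcAtlas,
    IsConeAnalyticOn (fun c => (e' (e.symm c) : EuclideanSpace ℝ (Fin (m + 1))))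
      (e.symm.trans e').source

section DC

variable {m : ℕ} {X : Type*} [TopologicalSpace X] [DCManifold m X]

/-- `(ψ.source, ψ)` is a local DC-coordinate system of `X`. -/
def IsDCCoordinate (ψ : OpenPartialHomeomorph X (doubleCone m)) : Prop :=
  ∀ e ∈ DCManifold.dcAtlas (m := m) (X := X),
    IsConeAnalyticOn (fun c => (e (ψ.symm c) : EuclideanSpace ℝ (Fin (m + 1))))
      (ψ.symm.trans e).source ∧
    IsConeAnalyticOn (fun c => (ψ (e.symm c) : EuclideanSpace ℝ (Fin (m + 1))))
      (e.symm.trans ψ).source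

variable (m X) in
/-- The set of DC-points: those points that some local DC-coordinate system sends to the
standard double-cone point. -/
def dcPoints : Set X :=
  {p | ∃ ψ : OpenPartialHomeomorph X (doubleCone m), IsDCCoordinate ψ ∧ p ∈ ψ.source ∧
    (ψ p : EuclideanSpace ℝ (Fin (m + 1))) = 0}

/-- DC-analytic maps from a DC-manifold to an embedded real analytic submanifold `N` of `ℝ^k`
(maps to `N` are real analytic iff they are so as maps to the ambient space). -/
def IsDCAnalytic (m : ℕ) {X : Type*} [TopologicalSpace X] [DCManifold m X] {k : ℕ}
    {N : Set (EuclideanSpace ℝ (Fin k))} (f : X → N) : Prop :=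
  Continuous f ∧ ∀ e ∈ DCManifold.dcAtlas (m := m) (X := X),
    IsConeAnalyticOn (fun c => (f (e.symm c) : EuclideanSpace ℝ (Fin k))) e.target

/-- A map from a normed space (an ordinary real analytic manifold, i.e. a DC-manifold without
DC-points) to a DC-manifold is DC-analytic if it is continuous and its expressions in the
charts of the DC-structure are real analytic maps to `ℝ^{m+1}`. -/
def IsDCAnalyticFrom (m : ℕ) {X : Type*} [TopologicalSpace X] [DCManifold m X]
    {V : Type*} [NormedAddCommGroup V] [NormedSpace ℝ V] (φ : V → X) : Prop :=
  Continuous φ ∧ ∀ e ∈ DCManifold.dcAtlas (m := m) (X := X),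
    AnalyticOnNhd ℝ (fun q => (e (φ q) : EuclideanSpace ℝ (Fin (m + 1)))) (φ ⁻¹' e.source)

/-- A real analytic diffeomorphism from an open subset of the embedded submanifold
`N ⊆ ℝ^k` onto an open subset of `ℝ^n`: a homeomorphism that is locally the restriction
of a real analytic map of the ambient space, and whose inverse is real analytic as a map
to the ambient space. -/
def IsAnalyticDiffeo {k n : ℕ} {N : Set (EuclideanSpace ℝ (Fin k))}
    (Φ : OpenPartialHomeomorph N (EuclideanSpace ℝ (Fin n))) : Prop :=
  (∀ y ∈ Φ.source, ∃ G : EuclideanSpace ℝ (Fin k) → EuclideanSpace ℝ (Fin n),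
    AnalyticAt ℝ G y ∧ ∀ᶠ z in 𝓝 y, Φ z = G z) ∧
  AnalyticOnNhd ℝ (fun u => (Φ.symm u : EuclideanSpace ℝ (Fin k))) Φ.target

/-- `a ↦ (a, 0, …, 0)` -/
def padZero {m : ℕ} (n : ℕ) (a : EuclideanSpace ℝ (Fin (m + 1))) : EuclideanSpace ℝ (Fin n) :=
  WithLp.toLp 2 fun i => if h : (i : ℕ) < m + 1 then a ⟨i, h⟩ else 0

/-- `p` is a DC-regular point of `f : X^m → N^n`. -/
def IsDCRegularAt (m : ℕ) {X : Type*} [TopologicalSpace X] [DCManifold m X] (n : ℕ) {k : ℕ}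
    {N : Set (EuclideanSpace ℝ (Fin k))} (f : X → N) (p : X) : Prop :=
  ∃ φ : OpenPartialHomeomorph X (doubleCone m), IsDCCoordinate φ ∧ p ∈ φ.source ∧
    ∃ Φ : OpenPartialHomeomorph N (EuclideanSpace ℝ (Fin n)), IsAnalyticDiffeo Φ ∧
      MapsTo f φ.source Φ.source ∧
      ∀ a ∈ φ.target, Φ (f (φ.symm a)) = padZero n (a : EuclideanSpace ℝ (Fin (m + 1)))

/-- Real analytic DC-immersions of an `m`-dimensional DC-manifold into an `n`-dimensional
manifold `N`, `n > m`. -/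
def IsDCImmersion (m : ℕ) {X : Type*} [TopologicalSpace X] [DCManifold m X] (n : ℕ) {k : ℕ}
    {N : Set (EuclideanSpace ℝ (Fin k))} (f : X → N) : Prop :=
  m < n ∧ IsDCAnalytic m f ∧ ∀ p, IsDCRegularAt m n f p

/-- `f₂` is an analytic extension of `f₁` (whose domain is a normed space `V`): `f₁` factors
through `f₂` by a DC-analytic map, and the image of `f₁` is a proper subset of that of `f₂`. -/
def IsAnalyticExtension (m : ℕ) {X : Type*} [TopologicalSpace X] [DCManifold m X]
    {V : Type*} [NormedAddCommGroup V] [NormedSpace ℝ V] {k : ℕ}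
    {N : Set (EuclideanSpace ℝ (Fin k))} (f₂ : X → N) (f₁ : V → N) : Prop :=
  AnalyticOnNhd ℝ (fun q => (f₁ q : EuclideanSpace ℝ (Fin k))) univ ∧ IsDCAnalytic m f₂ ∧
    (∃ φ : V → X, IsDCAnalyticFrom m φ ∧ f₁ = f₂ ∘ φ) ∧ range f₁ ⊂ range f₂

end DC

/-! ### Surfaces in de Sitter 3-space -/

/-- The Lorentzian inner product of signature `(-,+,+,+)` on `ℝ⁴`. -/
def lorentz (x y : EuclideanSpace ℝ (Fin 4)) : ℝ :=
  -(x 0 * y 0) + x 1 * y 1 + x 2 * y 2 + x 3 * y 3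

/-- De Sitter 3-space `S³₁`. -/
def deSitter : Set (EuclideanSpace ℝ (Fin 4)) := {x | lorentz x x = 1}

/-- first derivative of `F` in the direction `v` -/
noncomputable def dirD (F : ℝ × ℝ → EuclideanSpace ℝ (Fin 4)) (v q : ℝ × ℝ) :
    EuclideanSpace ℝ (Fin 4) := fderiv ℝ F q v

/-- coefficients `⟨F_v, F_w⟩` of the first fundamental form -/
noncomputable def firstForm (F : ℝ × ℝ → EuclideanSpace ℝ (Fin 4)) (q v w : ℝ × ℝ) : ℝ :=
  lorentz (dirD F v q) (dirD F w q)

/-- coefficients `⟨F_{vw}, ν⟩` of the second fundamental form with respect to the normal `ν` -/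
noncomputable def secondForm (F ν : ℝ × ℝ → EuclideanSpace ℝ (Fin 4)) (q v w : ℝ × ℝ) : ℝ :=
  lorentz (dirD (dirD F v) w q) (ν q)

/-- determinant of the first fundamental form -/
noncomputable def gramDet (F : ℝ × ℝ → EuclideanSpace ℝ (Fin 4)) (q : ℝ × ℝ) : ℝ :=
  firstForm F q (1, 0) (1, 0) * firstForm F q (0, 1) (0, 1) - firstForm F q (1, 0) (0, 1) ^ 2

/-- mean curvature: half the trace of the second fundamental form with respect to the first -/
noncomputable def meanCurvature (F ν : ℝ × ℝ → EuclideanSpace ℝ (Fin 4)) (q : ℝ × ℝ) : ℝ :=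
  (firstForm F q (0, 1) (0, 1) * secondForm F ν q (1, 0) (1, 0)
    - 2 * firstForm F q (1, 0) (0, 1) * secondForm F ν q (1, 0) (0, 1)
    + firstForm F q (1, 0) (1, 0) * secondForm F ν q (0, 1) (0, 1)) / (2 * gramDet F q)

/-- A surface `F : D → S³₁`, `D ⊆ ℝ²`, given as a map to `ℝ⁴`, is a space-like immersion
(the induced metric is positive definite, so `F` is an immersion) of constant mean curvature
one with respect to a continuous unit normal field `ν`
(time-like, tangent to `S³₁`, orthogonal to the surface). -/
def IsSpaceLikeCMCOneOn (F : ℝ × ℝ → EuclideanSpace ℝ (Fin 4)) (D : Set (ℝ × ℝ)) : Prop :=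
  AnalyticOnNhd ℝ F D ∧ (∀ q ∈ D, F q ∈ deSitter) ∧
    (∀ q ∈ D, ∀ v : ℝ × ℝ, v ≠ 0 → 0 < firstForm F q v v) ∧
    ∃ ν : ℝ × ℝ → EuclideanSpace ℝ (Fin 4), ContinuousOn ν D ∧ ∀ q ∈ D,
      lorentz (ν q) (ν q) = -1 ∧ lorentz (ν q) (F q) = 0 ∧
      (∀ v, lorentz (ν q) (dirD F v q) = 0) ∧ meanCurvature F ν q = 1

section Surface

variable {X : Type*} [TopologicalSpace X] [DCManifold 2 X]

/-- Analytic local parametrizations of (the part without DC-points of) a 2-dimensional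
DC-manifold: homeomorphisms `κ` from an open set of `ℝ²` onto an open set of `X` whose
expressions in the charts, as maps to `ℝ³`, are real analytic immersions. -/
def IsAnalyticParam (κ : OpenPartialHomeomorph (ℝ × ℝ) X) : Prop :=
  ∀ e ∈ DCManifold.dcAtlas (m := 2) (X := X), ∀ q ∈ κ.source ∩ κ ⁻¹' e.source,
    AnalyticAt ℝ (fun r => (e (κ r) : EuclideanSpace ℝ (Fin 3))) q ∧
    Function.Injective (fderiv ℝ (fun r => (e (κ r) : EuclideanSpace ℝ (Fin 3))) q)

/-- Near `p`, the map `f` is a space-like immersion of constant mean curvature one. -/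
def IsSpaceLikeCMCOneAt (f : X → deSitter) (p : X) : Prop :=
  ∃ κ : OpenPartialHomeomorph (ℝ × ℝ) X, IsAnalyticParam κ ∧ p ∈ κ.target ∧
    IsSpaceLikeCMCOneOn (fun q => (f (κ q) : EuclideanSpace ℝ (Fin 4))) κ.source

/-- `f` is an analytic immersion near `p`, and `p` is a light-like point of `f`: the induced
metric is degenerate at `p`. -/
def IsLightLikeAt (f : X → deSitter) (p : X) : Prop :=
  ∃ κ : OpenPartialHomeomorph (ℝ × ℝ) X, IsAnalyticParam κ ∧ p ∈ κ.target ∧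
    (∀ q ∈ κ.source, AnalyticAt ℝ (fun r => (f (κ r) : EuclideanSpace ℝ (Fin 4))) q ∧
      Function.Injective (fderiv ℝ (fun r => (f (κ r) : EuclideanSpace ℝ (Fin 4))) q)) ∧
    gramDet (fun r => (f (κ r) : EuclideanSpace ℝ (Fin 4))) (κ.symm p) = 0

/-- Real analytic space-like CMC-1 DC-immersions: DC-immersions of a connected DC-manifold
that, off the DC-points, are space-like of constant mean curvature one, where light-like
points are admitted but the space-like points have to be dense. -/
def IsSpaceLikeCMCOneDCImmersion (f : X → deSitter) : Prop :=
  ConnectedSpace X ∧ IsDCImmersion 2 3 f ∧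
    (∀ p ∉ dcPoints 2 X, IsSpaceLikeCMCOneAt f p ∨ IsLightLikeAt f p) ∧
    Dense {p : X | p ∉ dcPoints 2 X ∧ IsSpaceLikeCMCOneAt f p}

end Surface

/-! ### The G-catenoid of type SP and its extension -/

/-- the profile curve `Γ_SP` -/
noncomputable def profileSP (t : ℝ) : Fin 4 → ℝ :=
  ![-t / 2, t * Real.cos t / 2 - Real.sin t, t * Real.sin t / 2 + Real.cos t, 0]

/-- the one-parameter group of boosts -/
noncomputable def boostSP (s : ℝ) : Matrix (Fin 4) (Fin 4) ℝ :=
  !![Real.cosh s, 0, 0, Real.sinh s;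
     0, 1, 0, 0;
     0, 0, 1, 0;
     Real.sinh s, 0, 0, Real.cosh s]

theorem boost_profile_mem_deSitter (q : ℝ × ℝ) :
    WithLp.toLp 2 ((boostSP q.1).mulVec (profileSP q.2)) ∈ deSitter := by
  simp only [deSitter, lorentz, mem_ofPred_eq, boostSP, profileSP, Matrix.mulVec, dotProduct,
    Fin.sum_univ_four]
  simp
  have h1 := Real.cosh_sq q.1
  have h2 := Real.sin_sq_add_cos_sq q.2
  linear_combination (-(q.2 ^ 2) / 4) * h1 + (1 + q.2 ^ 2 / 4) * h2

/-- The G-catenoid `f_SP : ℝ² → S³₁` of type SP. -/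
noncomputable def fSP (q : ℝ × ℝ) : deSitter :=
  ⟨WithLp.toLp 2 ((boostSP q.1).mulVec (profileSP q.2)), boost_profile_mem_deSitter q⟩

/-- `X_SP = {(ξ, η, t) ; ξ η = t² / 4} ⊆ ℝ³` -/
def XSP : Set (EuclideanSpace ℝ (Fin 3)) := {p | p 0 * p 1 = p 2 ^ 2 / 4}

theorem ext_mem_deSitter (p : XSP) :
    ((1 / 2 : ℝ) • !₂[p.1 0 + p.1 1, p.1 2 * Real.cos (p.1 2) - 2 * Real.sin (p.1 2),
      p.1 2 * Real.sin (p.1 2) + 2 * Real.cos (p.1 2), p.1 0 - p.1 1] :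
        EuclideanSpace ℝ (Fin 4)) ∈ deSitter := by
  have hp : p.1 0 * p.1 1 = p.1 2 ^ 2 / 4 := p.2
  have h2 := Real.sin_sq_add_cos_sq (p.1 2)
  simp only [deSitter, lorentz, mem_ofPred_eq]
  simp
  linear_combination -hp + (1 + p.1 2 ^ 2 / 4) * h2

/-- The map `f̃_SP : X_SP → S³₁`. -/
noncomputable def fSPExt (p : XSP) : deSitter :=
  ⟨(1 / 2 : ℝ) • !₂[p.1 0 + p.1 1, p.1 2 * Real.cos (p.1 2) - 2 * Real.sin (p.1 2),
    p.1 2 * Real.sin (p.1 2) + 2 * Real.cos (p.1 2), p.1 0 - p.1 1], ext_mem_deSitter p⟩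

/-- The vertex `(0,0,0)` of `X_SP`. -/
def vertexSP : XSP := ⟨0, by simp [XSP]⟩

theorem chart_mem (p : XSP) :
    (!₂[p.1 0 - p.1 1, p.1 2, p.1 0 + p.1 1] : EuclideanSpace ℝ (Fin 3)) ∈ doubleCone 2 := by
  have hp : p.1 0 * p.1 1 = p.1 2 ^ 2 / 4 := p.2
  simp [doubleCone, Fin.sum_univ_two, Fin.last]
  linear_combination (-4) * hp

theorem chart_inv_mem (c : doubleCone 2) :
    (!₂[(c.1 2 + c.1 0) / 2, (c.1 2 - c.1 0) / 2, c.1 1] : EuclideanSpace ℝ (Fin 3)) ∈ XSP := by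
  have hc : c.1 0 ^ 2 + c.1 1 ^ 2 = c.1 2 ^ 2 := by
    have := c.2
    simpa [doubleCone, Fin.sum_univ_two, Fin.last] using this
  simp [XSP]
  linear_combination (-1 / 4) * hc

/-- The global chart `(ξ, η, t) ↦ (ξ - η, t, ξ + η)` of `X_SP`, restriction of a linear
isomorphism of `ℝ³`. -/
noncomputable def chartSP : XSP ≃ₜ doubleCone 2 where
  toFun p := ⟨!₂[p.1 0 - p.1 1, p.1 2, p.1 0 + p.1 1], chart_mem p⟩
  invFun c := ⟨!₂[(c.1 2 + c.1 0) / 2, (c.1 2 - c.1 0) / 2, c.1 1], chart_inv_mem c⟩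
  left_inv p := by
    ext i
    fin_cases i <;> simp
  right_inv c := by
    ext i
    fin_cases i <;> simp <;> ring
  continuous_toFun := by fun_prop
  continuous_invFun := by fun_prop

theorem isConnected_doubleCone (m : ℕ) : IsConnected (univ : Set (doubleCone m)) := by
  have h0 : (0 : EuclideanSpace ℝ (Fin (m + 1))) ∈ doubleCone m := by simp [doubleCone]
  have hst : StarConvex ℝ (0 : EuclideanSpace ℝ (Fin (m + 1))) (doubleCone m) := by
    rw [starConvex_zero_iff]
    intro x hx a _ _
    simp only [doubleCone, mem_ofPred_eq, PiLp.smul_apply, smul_eq_mul, mul_pow] at hx ⊢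
    rw [← Finset.mul_sum, hx]
  have := (hst.isPathConnected h0).isConnected
  rw [isConnected_iff_connectedSpace] at this
  exact isConnected_univ

theorem isClosed_XSP : IsClosed XSP := by
  unfold XSP
  exact isClosed_eq (by fun_prop) (by fun_prop)

/-- The DC-structure of `X_SP`, given by one global chart. -/
noncomputable instance : DCManifold 2 XSP where
  locallyCompact := isClosed_XSP.locallyCompactSpace
  t2 := inferInstance
  secondCountable := inferInstance
  dcAtlas := {chartSP.toOpenPartialHomeomorph}
  cover x := ⟨_, mem_singleton _, mem_univ x⟩
  connected := by
    rintro e rfl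
    exact isConnected_doubleCone 2
  transition := by
    rintro e rfl e' rfl
    refine ⟨univ, isOpen_univ, by simp, id, fun x _ => analyticAt_id, ?_⟩
    intro x _
    simp

/-! ### Entire functions of the square root -/

/-! Everything rests on two readings of the extended map. On `XSP` one has `y₀² - y₃² = ξη = t²/4`,
so `T = 4(y₀² - y₃²)` equals `t²`, and `y₁ + i y₂ = e^{it}(t + 2i)/2`.

Completeness. The coordinate `2 y₂ = t sin t + 2 cos t` is even in `t`, hence an entire function of
`T`; the equation of de Sitter space then gives `y₁` up to sign, and `t ↦ -t` changes that sign. So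
the image is cut out by one analytic equation and the inequality `T ≥ 0` (`mem_range_fSPExt_iff`).
Along an analytic curve the equation persists by the identity theorem. The inequality persists
because the equation has no solution in de Sitter space with `-1 ≤ T < 0` (`nonneg_of_entire_eq`):
there the trigonometric functions become hyperbolic and a square would have to be negative. A curve
that reached `T < 0` would cross this gap.

Regularity at the cone point. In polar coordinates of the `(y₁, y₂)`-plane the image has angle `t +
π/2 - arctan(t/2)`, which has positive derivative, so `t` is an analytic function of the angle. The
radius on de Sitter space is a function of `y₀, y₃`. Hence `(2 y₃, t(angle), 2 y₀)` are analytic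
coordinates of the ambient space in which the map is the inclusion of the cone
(`fSPExt_eq_polarInv`, `polarHomeo`).

Curvature. Off the vertex `ξ` or `η` is a coordinate together with `t`; in these graph coordinates
the Gram determinant is `t⁴/(16x²)`, and an explicit unit normal gives mean curvature one for `t ≠
0`.

The vertex is the only DC-point for a topological reason: removing it from a neighbourhood separates
the two nappes, whereas every other point has a planar neighbourhood. -/

/-- A real power series whose coefficients satisfy `cₙ₊₁ / cₙ → 0` is analytic on `ℝ`. -/
theorem analyticAt_ofScalarsSum {c : ℕ → ℝ} (hc : ∀ n, c n ≠ 0)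
    (h : Tendsto (fun n => ‖c n.succ‖ / ‖c n‖) atTop (𝓝 0)) (x : ℝ) :
    AnalyticAt ℝ (FormalMultilinearSeries.ofScalarsSum c : ℝ → ℝ) x := by
  have hr := FormalMultilinearSeries.ofScalars_radius_eq_top_of_tendsto ℝ c
    (Eventually.of_forall hc) h
  have := (FormalMultilinearSeries.ofScalars ℝ c).hasFPowerSeriesOnBall (by rw [hr]; simp)
  exact this.analyticAt_of_mem (by rw [hr]; simp)

/-- The ratio is `1 / ((2n + k + 1)(2n + k + 2))`, which is at most `1 / (n + 1)`. The case `k = 0`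
serves the cosine series and `k = 1` the sine series. -/
theorem tendsto_inv_factorial_ratio (k : ℕ) :
    Tendsto (fun n : ℕ => ‖(-1 : ℝ) ^ n.succ / (2 * n.succ + k).factorial‖ /
      ‖(-1 : ℝ) ^ n / (2 * n + k).factorial‖) atTop (𝓝 0) := by
  refine squeeze_zero (fun n => by positivity) (fun n => ?_)
    (tendsto_one_div_add_atTop_nhds_zero_nat (𝕜 := ℝ))
  have h : (2 * n.succ + k).factorial =
      (2 * n + k + 2) * ((2 * n + k + 1) * (2 * n + k).factorial) := by
    rw [← Nat.factorial_succ, ← Nat.factorial_succ]; congr 1; omega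
  have hf : (0 : ℝ) < (2 * n + k).factorial := by positivity
  rw [h]
  simp only [norm_div, norm_pow, norm_neg, norm_one, one_pow, Nat.cast_mul, Nat.cast_add,
    Real.norm_natCast, norm_mul]
  push_cast
  rw [Real.norm_of_nonneg (by positivity), Real.norm_of_nonneg (by positivity)]
  rw [div_div_eq_mul_div, div_le_div_iff₀ (by positivity) (by positivity)]
  field_simp
  have hk : (0 : ℝ) ≤ k := by positivity
  have hn : (0 : ℝ) ≤ n := by positivity
  nlinarith [mul_nonneg hk hn, mul_nonneg hk hk, mul_nonneg hn hn]

/-- The entire function `cos √x`. -/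
noncomputable def cosSqrt : ℝ → ℝ :=
  FormalMultilinearSeries.ofScalarsSum fun n : ℕ => (-1 : ℝ) ^ n / (2 * n + 0).factorial

/-- The entire function `sin √x / √x`. -/
noncomputable def sincSqrt : ℝ → ℝ :=
  FormalMultilinearSeries.ofScalarsSum fun n : ℕ => (-1 : ℝ) ^ n / (2 * n + 1).factorial

theorem analyticAt_cosSqrt (x : ℝ) : AnalyticAt ℝ cosSqrt x :=
  analyticAt_ofScalarsSum (fun n => by positivity) (tendsto_inv_factorial_ratio 0) x

theorem analyticAt_sincSqrt (x : ℝ) : AnalyticAt ℝ sincSqrt x :=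
  analyticAt_ofScalarsSum (fun n => by positivity) (by simpa using tendsto_inv_factorial_ratio 1) x

theorem cosSqrt_sq (s : ℝ) : cosSqrt (s ^ 2) = Real.cos s := by
  rw [cosSqrt, FormalMultilinearSeries.ofScalarsSum_eq_tsum, Real.cos_eq_tsum]
  refine tsum_congr fun n => ?_
  rw [smul_eq_mul, add_zero, pow_mul]; ring

/-- At a negative argument the sign of `(-u²)ⁿ` cancels the alternating sign of the series, which
turns cosine into hyperbolic cosine. -/
theorem cosSqrt_neg_sq (u : ℝ) : cosSqrt (-u ^ 2) = Real.cosh u := by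
  rw [cosSqrt, FormalMultilinearSeries.ofScalarsSum_eq_tsum, Real.cosh_eq_tsum]
  refine tsum_congr fun n => ?_
  rw [smul_eq_mul, add_zero, pow_mul, neg_pow (u ^ 2) n,
    div_mul_eq_mul_div, ← mul_assoc, ← mul_pow]
  norm_num

theorem sincSqrt_sq (s : ℝ) : s * sincSqrt (s ^ 2) = Real.sin s := by
  rw [sincSqrt, FormalMultilinearSeries.ofScalarsSum_eq_tsum, Real.sin_eq_tsum, ← tsum_mul_left]
  refine tsum_congr fun n => ?_
  rw [smul_eq_mul, pow_succ s (2 * n), pow_mul s 2 n]; ring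

theorem sincSqrt_neg_sq (u : ℝ) : u * sincSqrt (-u ^ 2) = Real.sinh u := by
  rw [sincSqrt, FormalMultilinearSeries.ofScalarsSum_eq_tsum, Real.sinh_eq_tsum, ← tsum_mul_left]
  refine tsum_congr fun n => ?_
  rw [smul_eq_mul, pow_succ u (2 * n), pow_mul u 2 n, neg_pow (u ^ 2) n,
    div_mul_eq_mul_div, ← mul_assoc, ← mul_pow]
  norm_num
  ring

/-! ### Analytic completeness of the image -/

/-- The image of `fSPExt` in terms of the entire function `√x sin √x + 2 cos √x`. -/
theorem mem_range_fSPExt_iff (y : deSitter) : y ∈ range fSPExt ↔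
    0 ≤ 4 * (y.1 0 ^ 2 - y.1 3 ^ 2) ∧
    2 * y.1 2 = 4 * (y.1 0 ^ 2 - y.1 3 ^ 2) * sincSqrt (4 * (y.1 0 ^ 2 - y.1 3 ^ 2))
      + 2 * cosSqrt (4 * (y.1 0 ^ 2 - y.1 3 ^ 2)) := by
  constructor
  · rintro ⟨p, rfl⟩
    have hp : p.1 0 * p.1 1 = p.1 2 ^ 2 / 4 := p.2
    have hT : 4 * ((fSPExt p).1 0 ^ 2 - (fSPExt p).1 3 ^ 2) = p.1 2 ^ 2 := by
      simp [fSPExt]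
      linear_combination 4 * hp
    rw [hT, cosSqrt_sq]
    refine ⟨sq_nonneg _, ?_⟩
    rw [sq, mul_assoc, ← sq, sincSqrt_sq]
    simp [fSPExt]
  · rintro ⟨h0, h1⟩
    obtain ⟨s, hs⟩ : ∃ s : ℝ, 4 * (y.1 0 ^ 2 - y.1 3 ^ 2) = s ^ 2 :=
      ⟨_, (Real.sq_sqrt h0).symm⟩
    rw [hs, cosSqrt_sq, sq, mul_assoc, ← sq, sincSqrt_sq] at h1
    have hy : -(y.1 0 * y.1 0) + y.1 1 * y.1 1 + y.1 2 * y.1 2 + y.1 3 * y.1 3 = 1 := y.2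
    have hsc := Real.sin_sq_add_cos_sq s
    -- The equation of de Sitter space determines `y₁²` from `y₂` and `T = s²`.
    have h2 : (2 * y.1 1) ^ 2 = (s * Real.cos s - 2 * Real.sin s) ^ 2 := by
      linear_combination 4 * hy + hs - (2 * y.1 2 + s * Real.sin s + 2 * Real.cos s) * h1
        - (s ^ 2 + 4) * hsc
    obtain ⟨t, ht, h3, h4⟩ : ∃ t : ℝ, t ^ 2 = s ^ 2 ∧
        2 * y.1 1 = t * Real.cos t - 2 * Real.sin t ∧
        2 * y.1 2 = t * Real.sin t + 2 * Real.cos t := by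
      -- The expression for `2 y₁` is odd and the one for `2 y₂` is even, so the wrong sign is
      -- repaired by `t = -s`.
      rcases sq_eq_sq_iff_eq_or_eq_neg.1 h2 with h | h
      · exact ⟨s, rfl, h, h1⟩
      · refine ⟨-s, by ring, ?_, ?_⟩
        · rw [Real.cos_neg, Real.sin_neg]; linarith
        · rw [Real.cos_neg, Real.sin_neg]; linarith
    refine ⟨⟨!₂[y.1 0 + y.1 3, y.1 0 - y.1 3, t], ?_⟩, ?_⟩
    · simp [XSP]
      linear_combination hs / 4 - ht / 4
    · ext i
      fin_cases i <;> simp [fSPExt] <;> linarith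

/-- Points of de Sitter space on the zero set of the entire defining function cannot have
`4 (y₀² - y₃²)` negative and close to zero. -/
theorem nonneg_of_entire_eq {y : EuclideanSpace ℝ (Fin 4)} (hy : y ∈ deSitter)
    (h : 2 * y 2 = 4 * (y 0 ^ 2 - y 3 ^ 2) * sincSqrt (4 * (y 0 ^ 2 - y 3 ^ 2))
      + 2 * cosSqrt (4 * (y 0 ^ 2 - y 3 ^ 2))) (h1 : -1 ≤ 4 * (y 0 ^ 2 - y 3 ^ 2)) :
    0 ≤ 4 * (y 0 ^ 2 - y 3 ^ 2) := by
  by_contra! hneg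
  obtain ⟨u, hu0, hu⟩ : ∃ u : ℝ, 0 < u ∧ 4 * (y 0 ^ 2 - y 3 ^ 2) = -u ^ 2 :=
    ⟨√(-(4 * (y 0 ^ 2 - y 3 ^ 2))), Real.sqrt_pos.2 (by linarith),
      by rw [Real.sq_sqrt (by linarith)]; ring⟩
  rw [hu, cosSqrt_neg_sq] at h
  have h2 : 2 * y 2 = - (u * Real.sinh u) + 2 * Real.cosh u := by
    rw [h, ← sincSqrt_neg_sq u]; ring
  have hy' : -(y 0 * y 0) + y 1 * y 1 + y 2 * y 2 + y 3 * y 3 = 1 := hy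
  have hch := Real.cosh_sq u
  -- A square equals minus a square, so both vanish and `u cosh u = 2 sinh u`. This contradicts `u
  -- cosh u < 2u < 2 sinh u`, where `cosh u < 2` comes from `u ≤ 1`.
  have h3 : (2 * y 1) ^ 2 = -(u * Real.cosh u - 2 * Real.sinh u) ^ 2 := by
    linear_combination 4 * hy' + hu - (2 * y 2 - u * Real.sinh u + 2 * Real.cosh u) * h2
      + (u ^ 2 - 4) * hch
  have hu1 : u ≤ 1 := by nlinarith
  have h4 : u * Real.cosh u - 2 * Real.sinh u = 0 := by
    nlinarith [sq_nonneg (2 * y 1), sq_nonneg (u * Real.cosh u - 2 * Real.sinh u)]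
  have h5 : u < Real.sinh u := Real.self_lt_sinh_iff.2 hu0
  have h6 : Real.cosh u < 2 := by
    have h7 : Real.cosh u ≤ Real.cosh 1 := by
      rw [Real.cosh_le_cosh, abs_of_pos hu0, abs_one]; exact hu1
    have h8 : Real.cosh 1 < 2 := by
      rw [Real.cosh_eq]
      have := Real.exp_one_lt_d9
      have h9 : Real.exp (-1) < 1 := by rw [Real.exp_lt_one_iff]; norm_num
      linarith
    linarith
  nlinarith

theorem analyticallyComplete_range_fSPExt : AnalyticallyComplete deSitter (range fSPExt) := by
  refine ⟨⟨_, vertexSP, rfl⟩, fun Γ hΓ hN ⟨ε, hε, hS⟩ => ?_⟩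
  have hcoord : ∀ i, AnalyticOnNhd ℝ (fun t => Γ t i) (Icc 0 1) := fun i t ht =>
    ((EuclideanSpace.proj i : EuclideanSpace ℝ (Fin 4) →L[ℝ] ℝ).analyticAt _).comp (hΓ t ht)
  set T : ℝ → ℝ := fun t => 4 * (Γ t 0 ^ 2 - Γ t 3 ^ 2) with hT
  have hTan : AnalyticOnNhd ℝ T (Icc 0 1) := fun t ht =>
    analyticAt_const.mul (((hcoord 0 t ht).pow 2).sub ((hcoord 3 t ht).pow 2))
  have hmem : ∀ t (ht : t ∈ Icc (0 : ℝ) 1), Γ t ∈ Subtype.val '' range fSPExt ↔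
      0 ≤ T t ∧ 2 * Γ t 2 = T t * sincSqrt (T t) + 2 * cosSqrt (T t) := fun t ht => by
    rw [← mem_range_fSPExt_iff ⟨Γ t, hN t ht⟩]
    constructor
    · rintro ⟨y, hy, h⟩
      rwa [show (⟨Γ t, hN t ht⟩ : deSitter) = y from Subtype.ext h.symm]
    · exact fun h => ⟨_, h, rfl⟩
  have hε1 := hε.1
  have hε2 := hε.2
  have hEq : EqOn (fun t => 2 * Γ t 2) (fun t => T t * sincSqrt (T t) + 2 * cosSqrt (T t))
      (Icc 0 1) := by
    -- The base point `ε / 2` is interior to `[0, ε)`: the identity theorem needs agreement on a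
    -- two-sided neighbourhood.
    refine AnalyticOnNhd.eqOn_of_preconnected_of_eventuallyEq (𝕜 := ℝ) (z₀ := ε / 2)
      (fun t ht => analyticAt_const.mul (hcoord 2 t ht)) (fun t ht => ?_)
      isPreconnected_Icc ⟨by linarith, by linarith⟩ ?_
    · exact ((hTan t ht).mul ((analyticAt_sincSqrt _).comp (hTan t ht))).add
        (analyticAt_const.mul ((analyticAt_cosSqrt _).comp (hTan t ht)))
    · filter_upwards [Ioo_mem_nhds (show 0 < ε / 2 by linarith) (show ε / 2 < ε by linarith)]
        with t ht
      exact ((hmem t ⟨ht.1.le, by linarith [ht.2]⟩).1 (hS t ⟨ht.1.le, ht.2⟩)).2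
  intro t ht
  refine (hmem t ht).2 ⟨?_, hEq ht⟩
  by_contra! hneg
  have h0 : 0 ≤ T 0 :=
    ((hmem 0 ⟨le_rfl, zero_le_one⟩).1 (hS 0 ⟨le_rfl, hε1⟩)).1
  have hcont : ContinuousOn T (Icc 0 t) :=
    hTan.continuousOn.mono (Icc_subset_Icc_right ht.2)
  -- Truncating at `-1` yields a parameter whose value is still negative but lies in the forbidden
  -- range `[-1, 0)`.
  obtain ⟨τ, hτ, hτv⟩ := intermediate_value_Icc' ht.1 hcont
    (show max (T t) (-1) ∈ Icc (T t) (T 0) from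
      ⟨le_max_left _ _, max_le (by linarith) (by linarith)⟩)
  have hτ1 : τ ∈ Icc (0 : ℝ) 1 := ⟨hτ.1, hτ.2.trans ht.2⟩
  have h5 := nonneg_of_entire_eq (hN τ hτ1) (hEq hτ1)
    (show -1 ≤ T τ by rw [hτv]; exact le_max_right _ _)
  change 0 ≤ T τ at h5
  rw [hτv] at h5
  rcases le_max_iff.1 h5 with h | h <;> linarith

/-! ### Analytic parametrizations of `X_SP` minus the vertex -/

/-- Exchange of `ξ` and `η`. -/
def swapSP : XSP ≃ₜ XSP where
  toFun p := ⟨!₂[p.1 1, p.1 0, p.1 2], by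
    have hp : p.1 0 * p.1 1 = p.1 2 ^ 2 / 4 := p.2
    simp [XSP]; linarith⟩
  invFun p := ⟨!₂[p.1 1, p.1 0, p.1 2], by
    have hp : p.1 0 * p.1 1 = p.1 2 ^ 2 / 4 := p.2
    simp [XSP]; linarith⟩
  left_inv p := by ext i; fin_cases i <;> simp
  right_inv p := by ext i; fin_cases i <;> simp
  continuous_toFun := by fun_prop
  continuous_invFun := by fun_prop

open Classical in
/-- The parametrization `(x, t) ↦ (x, t² / (4 x), t)` of `X_SP ∩ {ξ ≠ 0}`. -/
noncomputable def paramPos : OpenPartialHomeomorph (ℝ × ℝ) XSP where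
  -- The vertex is a default value on `x = 0`, outside the source.
  toFun q := if h : q.1 ≠ 0 then ⟨!₂[q.1, q.2 ^ 2 / (4 * q.1), q.2], by
    simp [XSP]; field_simp⟩ else vertexSP
  invFun p := (p.1 0, p.1 2)
  source := {q | q.1 ≠ 0}
  target := {p | p.1 0 ≠ 0}
  map_source' q hq := by
    have hq' : q.1 ≠ 0 := hq
    simp [hq']
  map_target' p hp := hp
  left_inv' q hq := by
    have hq' : q.1 ≠ 0 := hq
    simp [hq']
  right_inv' p hp := by
    have hp' : p.1 0 ≠ 0 := hp
    have h : p.1 0 * p.1 1 = p.1 2 ^ 2 / 4 := p.2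
    ext i
    fin_cases i <;> simp [hp']
    field_simp
    linarith
  open_source := isOpen_ne_fun continuous_fst continuous_const
  open_target := isOpen_ne_fun (by fun_prop) continuous_const
  continuousOn_toFun := by
    rw [continuousOn_iff_continuous_domRestrict]
    have : Continuous fun q : {q : ℝ × ℝ | q.1 ≠ 0} =>
        (!₂[q.1.1, q.1.2 ^ 2 / (4 * q.1.1), q.1.2] : EuclideanSpace ℝ (Fin 3)) := by
      refine (PiLp.continuous_toLp 2 _).comp (continuous_pi fun i => ?_)
      fin_cases i
      · exact continuous_fst.comp continuous_subtype_val
      · refine Continuous.div (by fun_prop) (by fun_prop) fun q => ?_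
        exact mul_ne_zero four_ne_zero q.2
      · exact continuous_snd.comp continuous_subtype_val
    refine Continuous.subtype_mk this (fun q => ?_) |>.congr fun q => ?_
    · have := q.2
      simp only [mem_ofPred_eq] at this
      simp [XSP]
      field_simp
    · have := q.2
      simp only [mem_ofPred_eq] at this
      simp [this]
  continuousOn_invFun := by fun_prop

/-- The parametrizations `(x, t) ↦ (x, t² / (4 x), t)` and `(x, t) ↦ (t² / (4 x), x, t)`. -/
noncomputable def paramSP (b : Bool) : OpenPartialHomeomorph (ℝ × ℝ) XSP :=
  if b then paramPos else paramPos.trans swapSP.toOpenPartialHomeomorph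

/-- The sign attached to a parametrization. -/
def signSP (b : Bool) : ℝ := if b then 1 else -1

theorem signSP_mul_self (b : Bool) : signSP b * signSP b = 1 := by
  cases b <;> simp [signSP]

theorem paramSP_source (b : Bool) : (paramSP b).source = {q | q.1 ≠ 0} := by
  cases b <;> simp [paramSP, paramPos]

theorem mem_paramSP_target (b : Bool) (p : XSP) :
    p ∈ (paramSP b).target ↔ (if b then p.1 0 else p.1 1) ≠ 0 := by
  cases b <;> simp [paramSP, paramPos, swapSP]

theorem paramSP_symm (b : Bool) (p : XSP) :
    (paramSP b).symm p = (if b then p.1 0 else p.1 1, p.1 2) := by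
  cases b <;> simp [paramSP, paramPos, swapSP]

/-- The chart expression of a parametrization. -/
noncomputable def chartParam (b : Bool) (q : ℝ × ℝ) : EuclideanSpace ℝ (Fin 3) :=
  !₂[signSP b * (q.1 - q.2 ^ 2 / (4 * q.1)), q.2, q.1 + q.2 ^ 2 / (4 * q.1)]

/-- `fSPExt` in terms of a parametrization. -/
noncomputable def surfSP (σ : ℝ) (q : ℝ × ℝ) : EuclideanSpace ℝ (Fin 4) :=
  !₂[(q.1 + q.2 ^ 2 / (4 * q.1)) / 2, (q.2 * Real.cos q.2 - 2 * Real.sin q.2) / 2,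
    (q.2 * Real.sin q.2 + 2 * Real.cos q.2) / 2, σ * (q.1 - q.2 ^ 2 / (4 * q.1)) / 2]

theorem chartSP_paramSP (b : Bool) {q : ℝ × ℝ} (hq : q.1 ≠ 0) :
    (chartSP (paramSP b q) : EuclideanSpace ℝ (Fin 3)) = chartParam b q := by
  ext i
  cases b <;> fin_cases i <;> simp [paramSP, paramPos, chartSP, chartParam, hq, swapSP, signSP] <;>
    ring

theorem fSPExt_paramSP (b : Bool) {q : ℝ × ℝ} (hq : q.1 ≠ 0) :
    (fSPExt (paramSP b q) : EuclideanSpace ℝ (Fin 4)) = surfSP (signSP b) q := by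
  ext i
  cases b <;> fin_cases i <;> simp [paramSP, paramPos, fSPExt, surfSP, hq, swapSP, signSP] <;>
    ring

/-! ### Derivatives -/

theorem analyticAt_toLp {E : Type*} [NormedAddCommGroup E] [NormedSpace ℝ E] {n : ℕ}
    {f : E → Fin n → ℝ} {x : E} (h : ∀ i, AnalyticAt ℝ (fun y => f y i) x) :
    AnalyticAt ℝ (fun y => (WithLp.toLp 2 (f y) : EuclideanSpace ℝ (Fin n))) x :=
  ((PiLp.continuousLinearEquiv 2 ℝ fun _ : Fin n => ℝ).symm.analyticAt _).comp
    (AnalyticAt.pi h)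

theorem analyticAt_surfSP (σ : ℝ) {q : ℝ × ℝ} (hq : q.1 ≠ 0) : AnalyticAt ℝ (surfSP σ) q := by
  have h4 : 4 * q.1 ≠ 0 := mul_ne_zero four_ne_zero hq
  have hc : AnalyticAt ℝ (fun r : ℝ × ℝ => Real.cos r.2) q :=
    Real.analyticAt_cos.comp analyticAt_snd
  have hs : AnalyticAt ℝ (fun r : ℝ × ℝ => Real.sin r.2) q :=
    Real.analyticAt_sin.comp analyticAt_snd
  have hx : AnalyticAt ℝ (fun r : ℝ × ℝ => r.1) q := analyticAt_fst
  have ht : AnalyticAt ℝ (fun r : ℝ × ℝ => r.2) q := analyticAt_snd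
  refine analyticAt_toLp fun i => ?_
  fin_cases i <;> simp <;> fun_prop (disch := assumption)

theorem analyticAt_chartParam (b : Bool) {q : ℝ × ℝ} (hq : q.1 ≠ 0) :
    AnalyticAt ℝ (chartParam b) q := by
  have h4 : 4 * q.1 ≠ 0 := mul_ne_zero four_ne_zero hq
  have hx : AnalyticAt ℝ (fun r : ℝ × ℝ => r.1) q := analyticAt_fst
  have ht : AnalyticAt ℝ (fun r : ℝ × ℝ => r.2) q := analyticAt_snd
  refine analyticAt_toLp fun i => ?_
  fin_cases i <;> simp <;> fun_prop (disch := assumption)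

/-- The linear map `ℝ² → E` with given images of the standard basis. -/
noncomputable def ofPartials {E : Type*} [NormedAddCommGroup E] [NormedSpace ℝ E] (A B : E) :
    ℝ × ℝ →L[ℝ] E :=
  (ContinuousLinearMap.fst ℝ ℝ ℝ).smulRight A + (ContinuousLinearMap.snd ℝ ℝ ℝ).smulRight B

@[simp] theorem ofPartials_apply {E : Type*} [NormedAddCommGroup E] [NormedSpace ℝ E] (A B : E)
    (v : ℝ × ℝ) : ofPartials A B v = v.1 • A + v.2 • B := by
  simp [ofPartials]

theorem hasFDerivAt_ofPartials {n : ℕ} {F : ℝ × ℝ → EuclideanSpace ℝ (Fin n)}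
    {A B : EuclideanSpace ℝ (Fin n)} {q : ℝ × ℝ}
    (h : ∀ i, HasFDerivAt (fun r => F r i) (ofPartials (A i) (B i)) q) :
    HasFDerivAt F (ofPartials A B) q := by
  rw [← hasFDerivWithinAt_univ, hasFDerivWithinAt_euclidean]
  intro i
  rw [hasFDerivWithinAt_univ]
  exact (h i).congr_fderiv (by ext <;> simp)

theorem hasFDerivAt_fst_mul_snd {a b : ℝ → ℝ} {a' b' : ℝ} {q : ℝ × ℝ}
    (ha : HasDerivAt a a' q.1) (hb : HasDerivAt b b' q.2) :
    HasFDerivAt (fun r : ℝ × ℝ => a r.1 * b r.2) (ofPartials (a' * b q.2) (a q.1 * b')) q := by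
  have h1 : HasFDerivAt (fun r : ℝ × ℝ => a r.1) (a' • ContinuousLinearMap.fst ℝ ℝ ℝ) q :=
    ha.comp_hasFDerivAt q hasFDerivAt_fst
  have h2 : HasFDerivAt (fun r : ℝ × ℝ => b r.2) (b' • ContinuousLinearMap.snd ℝ ℝ ℝ) q :=
    hb.comp_hasFDerivAt q hasFDerivAt_snd
  convert! h1.mul h2 using 1
  ext <;> simp <;> ring

/-- Every component of the surface and of its first partials is a sum of two products of a function
of `x` and a function of `t`; this reduces all the differentiations to one variable. -/
theorem hasFDerivAt_add_fst_mul_snd {f : ℝ × ℝ → ℝ} {a b c d : ℝ → ℝ} {a' b' c' d' A B : ℝ}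
    {q : ℝ × ℝ} (ha : HasDerivAt a a' q.1) (hb : HasDerivAt b b' q.2)
    (hc : HasDerivAt c c' q.1) (hd : HasDerivAt d d' q.2)
    (hf : ∀ r : ℝ × ℝ, f r = a r.1 * b r.2 + c r.1 * d r.2)
    (hA : A = a' * b q.2 + c' * d q.2) (hB : B = a q.1 * b' + c q.1 * d') :
    HasFDerivAt f (ofPartials A B) q := by
  rw [show f = fun r => a r.1 * b r.2 + c r.1 * d r.2 from funext hf, hA, hB]
  convert! (hasFDerivAt_fst_mul_snd ha hb).add (hasFDerivAt_fst_mul_snd hc hd) using 1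
  ext <;> simp

/-- `∂ₓ` of `surfSP` -/
noncomputable def surfX (σ : ℝ) (q : ℝ × ℝ) : EuclideanSpace ℝ (Fin 4) :=
  !₂[(1 - q.2 ^ 2 / (4 * q.1 ^ 2)) / 2, 0, 0, σ * (1 + q.2 ^ 2 / (4 * q.1 ^ 2)) / 2]

/-- `∂ₜ` of `surfSP` -/
noncomputable def surfT (σ : ℝ) (q : ℝ × ℝ) : EuclideanSpace ℝ (Fin 4) :=
  !₂[q.2 / (4 * q.1), (-Real.cos q.2 - q.2 * Real.sin q.2) / 2,
    (-Real.sin q.2 + q.2 * Real.cos q.2) / 2, -σ * (q.2 / (4 * q.1))]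

/-- `∂ₓ∂ₓ` of `surfSP` -/
noncomputable def surfXX (σ : ℝ) (q : ℝ × ℝ) : EuclideanSpace ℝ (Fin 4) :=
  !₂[q.2 ^ 2 / (4 * q.1 ^ 3), 0, 0, -σ * (q.2 ^ 2 / (4 * q.1 ^ 3))]

/-- `∂ₓ∂ₜ` of `surfSP` -/
noncomputable def surfXT (σ : ℝ) (q : ℝ × ℝ) : EuclideanSpace ℝ (Fin 4) :=
  !₂[-q.2 / (4 * q.1 ^ 2), 0, 0, σ * (q.2 / (4 * q.1 ^ 2))]

/-- `∂ₜ∂ₜ` of `surfSP` -/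
noncomputable def surfTT (σ : ℝ) (q : ℝ × ℝ) : EuclideanSpace ℝ (Fin 4) :=
  !₂[1 / (4 * q.1), -q.2 * Real.cos q.2 / 2, -q.2 * Real.sin q.2 / 2, -σ * (1 / (4 * q.1))]

theorem hasDerivAt_inv_sq {x : ℝ} (hx : x ≠ 0) :
    HasDerivAt (fun y : ℝ => (y ^ 2)⁻¹) (-2 / x ^ 3) x := by
  convert! ((hasDerivAt_id x).pow 2).inv (pow_ne_zero 2 hx) using 1
  simp; field_simp

theorem hasDerivAt_sq' (x : ℝ) : HasDerivAt (fun y : ℝ => y ^ 2) (2 * x) x := by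
  simpa using hasDerivAt_pow 2 x

theorem hasFDerivAt_surfSP (σ : ℝ) {q : ℝ × ℝ} (hq : q.1 ≠ 0) :
    HasFDerivAt (surfSP σ) (ofPartials (surfX σ q) (surfT σ q)) q := by
  have hx := hasDerivAt_id q.1
  have hi := hasDerivAt_inv hq
  have ht := hasDerivAt_id q.2
  have hs := Real.hasDerivAt_sin q.2
  have hc := Real.hasDerivAt_cos q.2
  have h1 := hasDerivAt_const q.1 (1 / 2 : ℝ)
  have h0 := hasDerivAt_const q.1 (0 : ℝ)
  have h1' := hasDerivAt_const q.2 (1 / 2 : ℝ)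
  refine hasFDerivAt_ofPartials fun i => ?_
  fin_cases i
  · refine hasFDerivAt_add_fst_mul_snd hx h1' (hi.const_mul (1 / 8)) (hasDerivAt_sq' q.2)
      (fun r => ?_) ?_ ?_ <;> simp [surfSP, surfX, surfT] <;> field_simp <;> ring
  · refine hasFDerivAt_add_fst_mul_snd h1 ((ht.mul hc).sub (hs.const_mul 2)) h0 ht
      (fun r => ?_) ?_ ?_ <;> simp [surfSP, surfX, surfT] <;> ring
  · refine hasFDerivAt_add_fst_mul_snd h1 ((ht.mul hs).add (hc.const_mul 2)) h0 ht
      (fun r => ?_) ?_ ?_ <;> simp [surfSP, surfX, surfT] <;> ring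
  · refine hasFDerivAt_add_fst_mul_snd (hx.const_mul σ) h1' (hi.const_mul (-σ / 8))
      (hasDerivAt_sq' q.2) (fun r => ?_) ?_ ?_ <;> simp [surfSP, surfX, surfT] <;>
      field_simp <;> ring

theorem hasFDerivAt_surfX (σ : ℝ) {q : ℝ × ℝ} (hq : q.1 ≠ 0) :
    HasFDerivAt (surfX σ) (ofPartials (surfXX σ q) (surfXT σ q)) q := by
  have hi := hasDerivAt_inv_sq hq
  have h1 := hasDerivAt_const q.1 (1 / 2 : ℝ)
  have h0 := hasDerivAt_const q.1 (0 : ℝ)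
  have h1' := hasDerivAt_const q.2 (1 : ℝ)
  refine hasFDerivAt_ofPartials fun i => ?_
  fin_cases i
  · refine hasFDerivAt_add_fst_mul_snd h1 h1' (hi.const_mul (-1 / 8)) (hasDerivAt_sq' q.2)
      (fun r => ?_) ?_ ?_ <;> simp [surfXX, surfX, surfXT] <;> field_simp <;> ring
  · refine hasFDerivAt_add_fst_mul_snd h0 h1' h0 h1'
      (fun r => ?_) ?_ ?_ <;> simp [surfXX, surfX, surfXT]
  · refine hasFDerivAt_add_fst_mul_snd h0 h1' h0 h1'
      (fun r => ?_) ?_ ?_ <;> simp [surfXX, surfX, surfXT]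
  · refine hasFDerivAt_add_fst_mul_snd (h1.const_mul σ) h1' (hi.const_mul (σ / 8))
      (hasDerivAt_sq' q.2) (fun r => ?_) ?_ ?_ <;> simp [surfXX, surfX, surfXT] <;>
      field_simp <;> ring

theorem hasFDerivAt_surfT (σ : ℝ) {q : ℝ × ℝ} (hq : q.1 ≠ 0) :
    HasFDerivAt (surfT σ) (ofPartials (surfXT σ q) (surfTT σ q)) q := by
  have hi := hasDerivAt_inv hq
  have ht := hasDerivAt_id q.2
  have hs := Real.hasDerivAt_sin q.2
  have hc := Real.hasDerivAt_cos q.2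
  have h1 := hasDerivAt_const q.1 (1 / 2 : ℝ)
  have h0 := hasDerivAt_const q.1 (0 : ℝ)
  refine hasFDerivAt_ofPartials fun i => ?_
  fin_cases i
  · refine hasFDerivAt_add_fst_mul_snd (hi.const_mul (1 / 4)) ht h0 ht
      (fun r => ?_) ?_ ?_ <;> simp [surfT, surfXT, surfTT] <;> field_simp
  · refine hasFDerivAt_add_fst_mul_snd h1 (hc.neg.sub (ht.mul hs)) h0 ht
      (fun r => ?_) ?_ ?_ <;> simp [surfT, surfXT, surfTT] <;> ring
  · refine hasFDerivAt_add_fst_mul_snd h1 (hs.neg.add (ht.mul hc)) h0 ht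
      (fun r => ?_) ?_ ?_ <;> simp [surfT, surfXT, surfTT] <;> ring
  · refine hasFDerivAt_add_fst_mul_snd (hi.const_mul (-σ / 4)) ht h0 ht
      (fun r => ?_) ?_ ?_ <;> simp [surfT, surfXT, surfTT] <;> field_simp

/-! ### Fundamental forms -/

theorem dirD_surfSP (σ : ℝ) {q : ℝ × ℝ} (hq : q.1 ≠ 0) (v : ℝ × ℝ) :
    dirD (surfSP σ) v q = v.1 • surfX σ q + v.2 • surfT σ q := by
  rw [dirD, (hasFDerivAt_surfSP σ hq).fderiv, ofPartials_apply]

theorem eventually_fst_ne {q : ℝ × ℝ} (hq : q.1 ≠ 0) : ∀ᶠ r : ℝ × ℝ in 𝓝 q, r.1 ≠ 0 :=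
  continuous_fst.continuousAt.eventually_ne hq

theorem dirD_dirD_fst (σ : ℝ) {q : ℝ × ℝ} (hq : q.1 ≠ 0) (w : ℝ × ℝ) :
    dirD (dirD (surfSP σ) (1, 0)) w q = w.1 • surfXX σ q + w.2 • surfXT σ q := by
  have : dirD (surfSP σ) (1, 0) =ᶠ[𝓝 q] surfX σ := by
    filter_upwards [eventually_fst_ne hq] with r hr
    simp [dirD_surfSP σ hr]
  rw [dirD, this.fderiv_eq, (hasFDerivAt_surfX σ hq).fderiv, ofPartials_apply]

theorem dirD_dirD_snd (σ : ℝ) {q : ℝ × ℝ} (hq : q.1 ≠ 0) (w : ℝ × ℝ) :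
    dirD (dirD (surfSP σ) (0, 1)) w q = w.1 • surfXT σ q + w.2 • surfTT σ q := by
  have : dirD (surfSP σ) (0, 1) =ᶠ[𝓝 q] surfT σ := by
    filter_upwards [eventually_fst_ne hq] with r hr
    simp [dirD_surfSP σ hr]
  rw [dirD, this.fderiv_eq, (hasFDerivAt_surfT σ hq).fderiv, ofPartials_apply]

theorem firstForm_surfSP {σ : ℝ} (hσ : σ * σ = 1) {q : ℝ × ℝ} (hq : q.1 ≠ 0) (v w : ℝ × ℝ) :
    firstForm (surfSP σ) q v w = v.1 * w.1 * (q.2 ^ 2 / (4 * q.1 ^ 2))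
      - (v.1 * w.2 + v.2 * w.1) * (q.2 / (4 * q.1)) + v.2 * w.2 * ((1 + q.2 ^ 2) / 4) := by
  have hsc := Real.sin_sq_add_cos_sq q.2
  rw [firstForm, dirD_surfSP σ hq, dirD_surfSP σ hq]
  simp only [lorentz, surfX, surfT]
  simp
  field_simp
  linear_combination (16 * q.1 ^ 4 * v.2 * w.2 * (1 + q.2 ^ 2)) * hsc
    + ((v.1 * (4 * q.1 ^ 2 + q.2 ^ 2) - 2 * v.2 * q.1 * q.2)
      * (w.1 * (4 * q.1 ^ 2 + q.2 ^ 2) - 2 * w.2 * q.1 * q.2)) * hσ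

/-- Writing the metric as a sum of two squares makes positive definiteness visible when `t ≠ 0`: the
second square detects `v.2`, and then the first detects `v.1`. -/
theorem firstForm_surfSP_self {σ : ℝ} (hσ : σ * σ = 1) {q : ℝ × ℝ} (hq : q.1 ≠ 0) (v : ℝ × ℝ) :
    firstForm (surfSP σ) q v v =
      (v.1 * (q.2 / (2 * q.1)) - v.2 / 2) ^ 2 + (v.2 * q.2 / 2) ^ 2 := by
  rw [firstForm_surfSP hσ hq]
  field_simp
  ring

theorem gramDet_surfSP {σ : ℝ} (hσ : σ * σ = 1) {q : ℝ × ℝ} (hq : q.1 ≠ 0) :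
    gramDet (surfSP σ) q = q.2 ^ 4 / (16 * q.1 ^ 2) := by
  simp only [gramDet, firstForm_surfSP hσ hq]
  simp
  field_simp
  ring

/-- A unit normal field of `surfSP`. -/
noncomputable def normalSP (σ : ℝ) (q : ℝ × ℝ) : EuclideanSpace ℝ (Fin 4) :=
  (-1 / (2 * q.2 ^ 2)) • !₂[(q.2 ^ 2 + 2) * (q.1 + q.2 ^ 2 / (4 * q.1)),
    (q.2 ^ 3 - 2 * q.2) * Real.cos q.2 - 2 * q.2 ^ 2 * Real.sin q.2,
    (q.2 ^ 3 - 2 * q.2) * Real.sin q.2 + 2 * q.2 ^ 2 * Real.cos q.2,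
    σ * ((q.2 ^ 2 + 2) * (q.1 - q.2 ^ 2 / (4 * q.1)))]

theorem continuousOn_normalSP (σ : ℝ) :
    ContinuousOn (normalSP σ) ({q | q.1 ≠ 0} ∩ {q | q.2 ≠ 0}) := by
  intro q hq
  have h1 : 4 * q.1 ≠ 0 := mul_ne_zero four_ne_zero hq.1
  have h2 : 2 * q.2 ^ 2 ≠ 0 := mul_ne_zero two_ne_zero (pow_ne_zero 2 hq.2)
  refine ContinuousAt.continuousWithinAt (Filter.Tendsto.smul ?_ ?_)
  · exact ContinuousAt.div (by fun_prop) (by fun_prop) h2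
  · refine (PiLp.continuous_toLp 2 _).continuousAt.comp (continuousAt_pi.2 fun i => ?_)
    fin_cases i <;> simp <;> fun_prop (disch := assumption)

theorem normalSP_spec {σ : ℝ} (hσ : σ * σ = 1) {q : ℝ × ℝ} (hq : q.1 ≠ 0) (ht : q.2 ≠ 0) :
    lorentz (normalSP σ q) (normalSP σ q) = -1 ∧ lorentz (normalSP σ q) (surfSP σ q) = 0 ∧
      lorentz (normalSP σ q) (surfX σ q) = 0 ∧ lorentz (normalSP σ q) (surfT σ q) = 0 ∧
      lorentz (surfXX σ q) (normalSP σ q) = (q.2 ^ 2 + 2) / (4 * q.1 ^ 2) ∧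
      lorentz (surfXT σ q) (normalSP σ q) = -((q.2 ^ 2 + 2) / (4 * q.1 * q.2)) ∧
      lorentz (surfTT σ q) (normalSP σ q) = (q.2 ^ 4 - q.2 ^ 2 + 2) / (4 * q.2 ^ 2) := by
  have hσ' : σ ^ 2 = 1 := by rw [sq, hσ]
  have hsc := Real.sin_sq q.2
  refine ⟨?_, ?_, ?_, ?_, ?_, ?_, ?_⟩ <;>
    simp only [lorentz, normalSP, surfSP, surfX, surfT, surfXX, surfXT, surfTT] <;> simp <;>
    field_simp <;> ring_nf <;> simp only [hσ', hsc] <;> ring_nf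

theorem lorentz_comb_left (a b : ℝ) (x y z : EuclideanSpace ℝ (Fin 4)) :
    lorentz (a • x + b • y) z = a * lorentz x z + b * lorentz y z := by
  simp [lorentz]; ring

theorem lorentz_comm (x y : EuclideanSpace ℝ (Fin 4)) : lorentz x y = lorentz y x := by
  simp [lorentz]; ring

theorem meanCurvature_surfSP {σ : ℝ} (hσ : σ * σ = 1) {q : ℝ × ℝ} (hq : q.1 ≠ 0)
    (ht : q.2 ≠ 0) : meanCurvature (surfSP σ) (normalSP σ) q = 1 := by
  obtain ⟨-, -, -, -, h1, h2, h3⟩ := normalSP_spec hσ hq ht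
  simp only [meanCurvature, secondForm, dirD_dirD_fst σ hq, dirD_dirD_snd σ hq,
    lorentz_comb_left, h1, h2, h3, gramDet_surfSP hσ hq, firstForm_surfSP hσ hq]
  simp
  field_simp
  ring

theorem surfSP_mem_deSitter (b : Bool) {q : ℝ × ℝ} (hq : q.1 ≠ 0) :
    surfSP (signSP b) q ∈ deSitter := by
  rw [← fSPExt_paramSP b hq]
  exact (fSPExt _).2

theorem isSpaceLikeCMCOneOn_surfSP (b : Bool) :
    IsSpaceLikeCMCOneOn (surfSP (signSP b)) ({q | q.1 ≠ 0} ∩ {q | q.2 ≠ 0}) := by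
  have hσ := signSP_mul_self b
  refine ⟨fun q hq => analyticAt_surfSP _ hq.1, fun q hq => surfSP_mem_deSitter b hq.1,
    fun q hq v hv => ?_, normalSP (signSP b), continuousOn_normalSP _, fun q hq => ?_⟩
  · rw [firstForm_surfSP_self hσ hq.1]
    by_cases h2 : v.2 = 0
    · have h1 : v.1 ≠ 0 := fun h1 => hv (Prod.ext h1 h2)
      have : v.1 * (q.2 / (2 * q.1)) ≠ 0 :=
        mul_ne_zero h1 (div_ne_zero hq.2 (mul_ne_zero two_ne_zero hq.1))
      rw [h2]
      simp only [zero_div, sub_zero, zero_mul]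
      positivity
    · have : v.2 * q.2 / 2 ≠ 0 := div_ne_zero (mul_ne_zero h2 hq.2) two_ne_zero
      positivity
  · obtain ⟨h1, h2, h3, h4, -⟩ := normalSP_spec hσ hq.1 hq.2
    refine ⟨h1, h2, fun v => ?_, meanCurvature_surfSP hσ hq.1 hq.2⟩
    rw [dirD_surfSP _ hq.1, lorentz_comm, lorentz_comb_left, lorentz_comm, h3, lorentz_comm, h4]
    simp

/-! ### Space-like and light-like points -/

theorem injective_fderiv_chartParam (b : Bool) {q : ℝ × ℝ} (hq : q.1 ≠ 0) :
    Function.Injective (fderiv ℝ (chartParam b) q) := by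
  -- `L` is a linear left inverse of the parametrization: `(a₂ ± a₀) / 2` recovers `x` and `a₁`
  -- recovers `t`. The chain rule then makes `L` a left inverse of the derivative.
  let L : EuclideanSpace ℝ (Fin 3) →L[ℝ] ℝ × ℝ :=
    ((1 / 2 : ℝ) • ((EuclideanSpace.proj 2 : EuclideanSpace ℝ (Fin 3) →L[ℝ] ℝ) +
      signSP b • EuclideanSpace.proj 0)).prod (EuclideanSpace.proj 1)
  have hL : L ∘ chartParam b = id := by
    funext r
    have := signSP_mul_self b
    ext
    · simp [L, chartParam]
      linear_combination (r.1 - r.2 ^ 2 / (4 * r.1)) / 2 * this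
    · simp [L, chartParam]
  have h := L.hasFDerivAt.comp q (analyticAt_chartParam b hq).differentiableAt.hasFDerivAt
  rw [hL] at h
  have h' := h.unique (hasFDerivAt_id q)
  refine Function.LeftInverse.injective (g := L) fun v => ?_
  exact congrArg (fun A : ℝ × ℝ →L[ℝ] ℝ × ℝ => A v) h'

/-- This includes `t = 0`, where the metric degenerates, so it cannot be read off the first
fundamental form. Components 0 and 3 isolate `v.1`; components 1 and 2 are `v.2` times a vector of
squared length `(1 + t²) / 4`. -/
theorem injective_fderiv_surfSP {σ : ℝ} (hσ : σ * σ = 1) {q : ℝ × ℝ} (hq : q.1 ≠ 0) :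
    Function.Injective (fderiv ℝ (surfSP σ) q) := by
  rw [(hasFDerivAt_surfSP σ hq).fderiv]
  refine (injective_iff_map_eq_zero (ofPartials (surfX σ q) (surfT σ q))).2 fun v hv => ?_
  rw [ofPartials_apply] at hv
  have h (i : Fin 4) := congrArg (fun x : EuclideanSpace ℝ (Fin 4) => x i) hv
  have h0 := h 0
  have h1 := h 1
  have h2 := h 2
  have h3 := h 3
  simp [surfX, surfT] at h0 h1 h2 h3
  have hv1 : v.1 = 0 := by
    linear_combination h0 + σ * h3
      + (v.2 * (q.2 / (4 * q.1)) - v.1 * (1 + q.2 ^ 2 / (4 * q.1 ^ 2)) / 2) * hσ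
  have hv2 : v.2 = 0 := by
    have hp : (-Real.cos q.2 - q.2 * Real.sin q.2) ^ 2 +
        (-Real.sin q.2 + q.2 * Real.cos q.2) ^ 2 = 1 + q.2 ^ 2 := by
      linear_combination (1 + q.2 ^ 2) * Real.sin_sq_add_cos_sq q.2
    rcases h1 with h1 | h1
    · exact h1
    rcases h2 with h2 | h2
    · exact h2
    rw [h1, h2] at hp
    nlinarith [sq_nonneg q.2]
  exact Prod.ext hv1 hv2

theorem isAnalyticParam_of_eq (b : Bool) (κ : OpenPartialHomeomorph (ℝ × ℝ) XSP)
    (h : ⇑κ = paramSP b) (hs : κ.source ⊆ {q | q.1 ≠ 0}) : IsAnalyticParam κ := by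
  rintro e rfl q ⟨hq, -⟩
  have hq' : q.1 ≠ 0 := hs hq
  have heq : (fun r => (chartSP.toOpenPartialHomeomorph (κ r) : EuclideanSpace ℝ (Fin 3)))
      =ᶠ[𝓝 q] chartParam b := by
    filter_upwards [eventually_fst_ne hq'] with r hr
    rw [h, Homeomorph.toOpenPartialHomeomorph_apply, chartSP_paramSP b hr]
  rw [heq.fderiv_eq]
  exact ⟨(analyticAt_chartParam b hq').congr heq.symm, injective_fderiv_chartParam b hq'⟩

theorem isOpen_snd_ne : IsOpen {q : ℝ × ℝ | q.2 ≠ 0} :=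
  isOpen_ne_fun continuous_snd continuous_const

theorem fSPExt_comp_eventuallyEq (b : Bool) {q : ℝ × ℝ} (hq : q.1 ≠ 0) :
    (fun r => (fSPExt (paramSP b r) : EuclideanSpace ℝ (Fin 4))) =ᶠ[𝓝 q] surfSP (signSP b) := by
  filter_upwards [eventually_fst_ne hq] with r hr
  exact fSPExt_paramSP b hr

/-- Since second derivatives enter, agreement is needed near each point. This transfers the
computation from the explicit formula to the composite with a parametrization, which takes a default
value on `x = 0`. -/
theorem IsSpaceLikeCMCOneOn.congr {F G : ℝ × ℝ → EuclideanSpace ℝ (Fin 4)} {D : Set (ℝ × ℝ)}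
    (hF : IsSpaceLikeCMCOneOn F D) (h : ∀ q ∈ D, G =ᶠ[𝓝 q] F) : IsSpaceLikeCMCOneOn G D := by
  obtain ⟨h1, h2, h3, ν, h4, h5⟩ := hF
  have hd (q) (hq : q ∈ D) (v : ℝ × ℝ) : dirD G v =ᶠ[𝓝 q] dirD F v := by
    filter_upwards [Filter.EventuallyEq.fderiv (𝕜 := ℝ) (h q hq)] with r hr
    rw [dirD, dirD, hr]
  have hf (q) (hq : q ∈ D) (v w : ℝ × ℝ) : firstForm G q v w = firstForm F q v w := by
    rw [firstForm, firstForm, (hd q hq v).eq_of_nhds, (hd q hq w).eq_of_nhds]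
  have hs (q) (hq : q ∈ D) (v w : ℝ × ℝ) : secondForm G ν q v w = secondForm F ν q v w := by
    rw [secondForm, secondForm, dirD, (hd q hq v).fderiv_eq, dirD]
  refine ⟨fun q hq => (h1 q hq).congr (h q hq).symm, fun q hq => ?_, fun q hq v hv => ?_, ν, h4,
    fun q hq => ?_⟩
  · rw [(h q hq).eq_of_nhds]; exact h2 q hq
  · rw [hf q hq]; exact h3 q hq v hv
  · obtain ⟨a, b, c, d⟩ := h5 q hq
    refine ⟨a, by rw [(h q hq).eq_of_nhds, b], fun v => ?_, ?_⟩
    · rw [(hd q hq v).eq_of_nhds, c]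
    · simpa only [meanCurvature, gramDet, hf q hq, hs q hq] using d

theorem isSpaceLikeCMCOneAt_fSPExt {p : XSP} (hp : p.1 2 ≠ 0) : IsSpaceLikeCMCOneAt fSPExt p := by
  have hsrc : ((paramSP true).restrOpen _ isOpen_snd_ne).source =
      {q | q.1 ≠ 0} ∩ {q | q.2 ≠ 0} := by
    rw [OpenPartialHomeomorph.restrOpen_source, paramSP_source]
  -- Since `ξη = t²/4`, a non-zero `t` forces `ξ ≠ 0`, and the first parametrization suffices.
  have hp0 : p.1 0 ≠ 0 := by
    intro h
    have := p.2
    simp only [XSP, mem_ofPred_eq, h, zero_mul] at this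
    exact hp (by nlinarith)
  refine ⟨(paramSP true).restrOpen _ isOpen_snd_ne,
    isAnalyticParam_of_eq true _ rfl (hsrc.trans_subset inter_subset_left), ?_, ?_⟩
  · have h1 : p ∈ (paramSP true).target := by simpa [mem_paramSP_target] using hp0
    refine ⟨h1, ?_⟩
    change (paramSP true).symm p ∈ {q : ℝ × ℝ | q.2 ≠ 0}
    rw [paramSP_symm]
    exact hp
  · rw [hsrc]
    exact (isSpaceLikeCMCOneOn_surfSP true).congr fun q hq => fSPExt_comp_eventuallyEq true hq.1

theorem exists_mem_paramSP_target {p : XSP} (hp : p ≠ vertexSP) :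
    ∃ b, p ∈ (paramSP b).target := by
  by_contra! h
  have h0 : p.1 0 = 0 := by simpa [mem_paramSP_target] using h true
  have h1 : p.1 1 = 0 := by simpa [mem_paramSP_target] using h false
  have h2 := p.2
  simp only [XSP, mem_ofPred_eq, h0, zero_mul] at h2
  have h2' : p.1 2 = 0 := by nlinarith
  apply hp
  ext i
  fin_cases i <;> simp [vertexSP, h0, h1, h2']

theorem isLightLikeAt_fSPExt {p : XSP} (hp : p ≠ vertexSP) (ht : p.1 2 = 0) :
    IsLightLikeAt fSPExt p := by
  obtain ⟨b, hb⟩ := exists_mem_paramSP_target hp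
  have hσ := signSP_mul_self b
  refine ⟨paramSP b, isAnalyticParam_of_eq b _ rfl (paramSP_source b).subset, hb,
    fun q hq => ?_, ?_⟩
  · rw [paramSP_source] at hq
    have heq := fSPExt_comp_eventuallyEq b hq
    rw [heq.fderiv_eq]
    exact ⟨(analyticAt_surfSP _ hq).congr heq.symm, injective_fderiv_surfSP hσ hq⟩
  · have hq : ((paramSP b).symm p).1 ≠ 0 := by
      have := (paramSP b).map_target hb
      rwa [paramSP_source] at this
    have heq := fSPExt_comp_eventuallyEq b hq
    have h2 : ((paramSP b).symm p).2 = 0 := by rw [paramSP_symm]; exact ht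
    have := gramDet_surfSP hσ hq
    rw [h2] at this
    simp only [gramDet, firstForm, dirD] at this ⊢
    rw [heq.fderiv_eq, this]
    simp

/-! ### The polar angle of the profile curve -/

/-- The polar angle of `((t cos t - 2 sin t) / 2, (t sin t + 2 cos t) / 2)`. -/
noncomputable def angleSP (t : ℝ) : ℝ := t + (Real.pi / 2 - Real.arctan (t / 2))

theorem hasDerivAt_angleSP (t : ℝ) : HasDerivAt angleSP ((2 + t ^ 2) / (4 + t ^ 2)) t := by
  have h1 : HasDerivAt (fun s : ℝ => s / 2) (1 / 2) t := (hasDerivAt_id t).div_const 2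
  have h := (hasDerivAt_id t).add ((h1.arctan).const_sub (Real.pi / 2))
  refine h.congr_deriv ?_
  field_simp
  ring

theorem strictMono_angleSP : StrictMono angleSP :=
  strictMono_of_deriv_pos fun t => by rw [(hasDerivAt_angleSP t).deriv]; positivity

theorem analyticAt_arctan (t : ℝ) : AnalyticAt ℝ Real.arctan t :=
  contDiff_omega_iff_analyticOnNhd.1 Real.contDiff_arctan t (mem_univ t)

theorem analyticAt_angleSP (t : ℝ) : AnalyticAt ℝ angleSP t := by
  have h : AnalyticAt ℝ (fun s : ℝ => s / 2) t := by fun_prop (disch := norm_num)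
  exact analyticAt_id.add (analyticAt_const.sub
    (AnalyticAt.comp (f := fun s : ℝ => s / 2) (analyticAt_arctan _) h))

theorem continuous_angleSP : Continuous angleSP :=
  continuous_iff_continuousAt.2 fun t => (analyticAt_angleSP t).continuousAt

/-- The arctangent is bounded, so the angle lies strictly between `t` and `t + π`. -/
theorem surjective_angleSP : Function.Surjective angleSP := by
  refine continuous_angleSP.surjective ?_ ?_
  · refine tendsto_atTop_mono (fun t => ?_) tendsto_id
    have := Real.arctan_lt_pi_div_two (t / 2)
    simp only [angleSP, id]
    linarith
  · refine tendsto_atBot_mono (fun t => ?_) (show Tendsto (fun t => t + Real.pi) atBot atBot from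
      tendsto_atBot_add_const_right _ _ tendsto_id)
    have := Real.neg_pi_div_two_lt_arctan (t / 2)
    simp only [angleSP]
    linarith

/-- `angleSP` as a homeomorphism. -/
noncomputable def angleHomeo : ℝ ≃ₜ ℝ :=
  (StrictMono.orderIsoOfSurjective angleSP strictMono_angleSP surjective_angleSP).toHomeomorph

theorem angleSP_symm (x : ℝ) : angleSP (angleHomeo.symm x) = x := angleHomeo.apply_symm_apply x

theorem symm_angleSP (t : ℝ) : angleHomeo.symm (angleSP t) = t := angleHomeo.symm_apply_apply t

theorem analyticAt_angleHomeo_symm (x : ℝ) : AnalyticAt ℝ angleHomeo.symm x := by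
  have hd := hasDerivAt_angleSP (angleHomeo.symm x)
  have hne : (2 + (angleHomeo.symm x) ^ 2) / (4 + (angleHomeo.symm x) ^ 2) ≠ 0 := by positivity
  exact angleHomeo.toOpenPartialHomeomorph.analyticAt_symm (mem_univ x)
    (analyticAt_angleSP _) (hd.hasFDerivAt_equiv hne).fderiv

/-- Real part of `e^{it}(t + 2i)/2`: the factor `t/2 + i` has modulus `√(1 + t²/4)` and argument
`π/2 - arctan(t/2)`. -/
theorem sqrt_mul_cos_angleSP (t : ℝ) :
    √(1 + t ^ 2 / 4) * Real.cos (angleSP t) = (t * Real.cos t - 2 * Real.sin t) / 2 := by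
  have h : angleSP t = (t - Real.arctan (t / 2)) + Real.pi / 2 := by rw [angleSP]; ring
  have h2 : 1 + (t / 2) ^ 2 = 1 + t ^ 2 / 4 := by ring
  have h3 : √(1 + t ^ 2 / 4) ≠ 0 := by positivity
  rw [h, Real.cos_add_pi_div_two, Real.sin_sub, Real.cos_arctan, Real.sin_arctan, h2]
  field_simp
  ring

theorem sqrt_mul_sin_angleSP (t : ℝ) :
    √(1 + t ^ 2 / 4) * Real.sin (angleSP t) = (t * Real.sin t + 2 * Real.cos t) / 2 := by
  have h : angleSP t = (t - Real.arctan (t / 2)) + Real.pi / 2 := by rw [angleSP]; ring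
  have h2 : 1 + (t / 2) ^ 2 = 1 + t ^ 2 / 4 := by ring
  have h3 : √(1 + t ^ 2 / 4) ≠ 0 := by positivity
  rw [h, Real.sin_add_pi_div_two, Real.cos_sub, Real.cos_arctan, Real.sin_arctan, h2]
  field_simp
  ring

/-! ### Analytic coordinates of de Sitter space adapted to `fSPExt` -/

/-- The rotated complex coordinate `(y₁ + i y₂) e^{-i θ}`. -/
noncomputable def rotCoord (θ : ℝ) (y : EuclideanSpace ℝ (Fin 4)) : ℂ :=
  ((y 1 : ℝ) + (y 2 : ℝ) * Complex.I) * Complex.exp (-θ * Complex.I)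

theorem analyticAt_rotCoord (θ : ℝ) (y : EuclideanSpace ℝ (Fin 4)) :
    AnalyticAt ℝ (rotCoord θ) y := by
  have h (i : Fin 4) : AnalyticAt ℝ (fun y : EuclideanSpace ℝ (Fin 4) => ((y i : ℝ) : ℂ)) y :=
    (Complex.ofRealCLM ∘L (EuclideanSpace.proj i : EuclideanSpace ℝ (Fin 4) →L[ℝ] ℝ)).analyticAt y
  exact ((h 1).add ((h 2).mul analyticAt_const)).mul analyticAt_const

theorem analyticAt_arg {z : ℂ} (hz : z ∈ Complex.slitPlane) : AnalyticAt ℝ Complex.arg z := by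
  have h := (Complex.imCLM.analyticAt (Complex.log z)).comp
    ((analyticAt_clog hz).restrictScalars (𝕜 := ℝ))
  exact h.congr (Eventually.of_forall fun w => Complex.log_im w)

theorem norm_mul_exp_arg_rotCoord (θ : ℝ) (y : EuclideanSpace ℝ (Fin 4)) :
    (‖rotCoord θ y‖ : ℂ) * Complex.exp ((θ + Complex.arg (rotCoord θ y) : ℝ) * Complex.I) =
      (y 1 : ℝ) + (y 2 : ℝ) * Complex.I := by
  push_cast
  rw [add_mul, add_comm, Complex.exp_add, ← mul_assoc, Complex.norm_mul_exp_arg_mul_I, rotCoord,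
    mul_assoc, ← Complex.exp_add]
  simp

theorem norm_mul_cos_arg_rotCoord (θ : ℝ) (y : EuclideanSpace ℝ (Fin 4)) :
    ‖rotCoord θ y‖ * Real.cos (θ + Complex.arg (rotCoord θ y)) = y 1 := by
  have h := congrArg Complex.re (norm_mul_exp_arg_rotCoord θ y)
  rw [Complex.re_ofReal_mul, Complex.exp_ofReal_mul_I_re] at h
  simpa using h

theorem norm_mul_sin_arg_rotCoord (θ : ℝ) (y : EuclideanSpace ℝ (Fin 4)) :
    ‖rotCoord θ y‖ * Real.sin (θ + Complex.arg (rotCoord θ y)) = y 2 := by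
  have h := congrArg Complex.im (norm_mul_exp_arg_rotCoord θ y)
  rw [Complex.im_ofReal_mul, Complex.exp_ofReal_mul_I_im] at h
  simpa using h

theorem norm_rotCoord_sq (θ : ℝ) (y : EuclideanSpace ℝ (Fin 4)) :
    ‖rotCoord θ y‖ ^ 2 = y 1 ^ 2 + y 2 ^ 2 := by
  rw [← norm_mul_cos_arg_rotCoord θ y, ← norm_mul_sin_arg_rotCoord θ y, mul_pow, mul_pow,
    ← mul_add, Real.cos_sq_add_sin_sq, mul_one]

/-- On de Sitter space `y₁² + y₂² = 1 + y₀² - y₃²`, so the radius is no independent coordinate: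
`y₀`, `y₃` and the angle suffice. -/
theorem norm_rotCoord_eq_sqrt (θ : ℝ) {y : EuclideanSpace ℝ (Fin 4)} (hy : y ∈ deSitter) :
    ‖rotCoord θ y‖ = √(1 + ((2 * y 0) ^ 2 - (2 * y 3) ^ 2) / 4) := by
  have hy' : -(y 0 * y 0) + y 1 * y 1 + y 2 * y 2 + y 3 * y 3 = 1 := hy
  rw [← Real.sqrt_sq (norm_nonneg (rotCoord θ y)), norm_rotCoord_sq]
  congr 1
  linear_combination hy'

/-- The point of `ℝ⁴` with coordinates `u`. -/
noncomputable def polarInv (u : EuclideanSpace ℝ (Fin 3)) : EuclideanSpace ℝ (Fin 4) :=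
  !₂[u 2 / 2, √(1 + (u 2 ^ 2 - u 0 ^ 2) / 4) * Real.cos (angleSP (u 1)),
    √(1 + (u 2 ^ 2 - u 0 ^ 2) / 4) * Real.sin (angleSP (u 1)), u 0 / 2]

theorem polarInv_mem {u : EuclideanSpace ℝ (Fin 3)} (hu : 0 < 1 + (u 2 ^ 2 - u 0 ^ 2) / 4) :
    polarInv u ∈ deSitter := by
  have h := Real.sq_sqrt hu.le
  have hsc := Real.sin_sq_add_cos_sq (angleSP (u 1))
  simp only [deSitter, lorentz, polarInv, mem_ofPred_eq]
  simp
  linear_combination h + √(1 + (u 2 ^ 2 - u 0 ^ 2) / 4) ^ 2 * hsc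

theorem analyticAt_polarInv {u : EuclideanSpace ℝ (Fin 3)}
    (hu : 0 < 1 + (u 2 ^ 2 - u 0 ^ 2) / 4) : AnalyticAt ℝ polarInv u := by
  have hc (i : Fin 3) : AnalyticAt ℝ (fun w : EuclideanSpace ℝ (Fin 3) => w i) u :=
    (EuclideanSpace.proj i : EuclideanSpace ℝ (Fin 3) →L[ℝ] ℝ).analyticAt u
  have hr : AnalyticAt ℝ (fun w : EuclideanSpace ℝ (Fin 3) => 1 + (w 2 ^ 2 - w 0 ^ 2) / 4) u :=
    analyticAt_const.add
      ((((hc 2).pow 2).sub ((hc 0).pow 2)).div analyticAt_const four_ne_zero)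
  have hs : AnalyticAt ℝ (fun w : EuclideanSpace ℝ (Fin 3) => √(1 + (w 2 ^ 2 - w 0 ^ 2) / 4)) u :=
    AnalyticAt.comp (g := Real.sqrt) (Real.contDiffAt_sqrt hu.ne').analyticAt hr
  have ha : AnalyticAt ℝ (fun w : EuclideanSpace ℝ (Fin 3) => angleSP (w 1)) u :=
    AnalyticAt.comp (f := fun w : EuclideanSpace ℝ (Fin 3) => w 1) (analyticAt_angleSP _) (hc 1)
  refine analyticAt_toLp fun i => ?_
  fin_cases i
  · exact (hc 2).div analyticAt_const two_ne_zero
  · exact hs.mul (Real.analyticAt_cos.comp ha)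
  · exact hs.mul (Real.analyticAt_sin.comp ha)
  · exact (hc 0).div analyticAt_const two_ne_zero

/-- The coordinates `(2 y₃, angleSP⁻¹ (arg (y₁ + i y₂)), 2 y₀)`, where the argument is taken
close to `θ`. -/
noncomputable def polarMap (θ : ℝ) (y : EuclideanSpace ℝ (Fin 4)) : EuclideanSpace ℝ (Fin 3) :=
  !₂[2 * y 3, angleHomeo.symm (θ + Complex.arg (rotCoord θ y)), 2 * y 0]

theorem analyticAt_polarMap {θ : ℝ} {y : EuclideanSpace ℝ (Fin 4)}
    (hy : rotCoord θ y ∈ Complex.slitPlane) : AnalyticAt ℝ (polarMap θ) y := by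
  have hc (i : Fin 4) : AnalyticAt ℝ (fun w : EuclideanSpace ℝ (Fin 4) => w i) y :=
    (EuclideanSpace.proj i : EuclideanSpace ℝ (Fin 4) →L[ℝ] ℝ).analyticAt y
  refine analyticAt_toLp fun i => ?_
  fin_cases i
  · exact analyticAt_const.mul (hc 3)
  · exact (analyticAt_angleHomeo_symm _).comp (analyticAt_const.add
      (AnalyticAt.comp (analyticAt_arg hy) (analyticAt_rotCoord θ y)))
  · exact analyticAt_const.mul (hc 0)

theorem rotCoord_polarInv (θ : ℝ) (u : EuclideanSpace ℝ (Fin 3)) :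
    rotCoord θ (polarInv u) = (√(1 + (u 2 ^ 2 - u 0 ^ 2) / 4) : ℝ) *
      (Complex.cos (angleSP (u 1) - θ : ℝ) + Complex.sin (angleSP (u 1) - θ : ℝ) * Complex.I) := by
  rw [← Complex.exp_mul_I]
  have h : Complex.exp ((angleSP (u 1) - θ : ℝ) * Complex.I) =
      Complex.exp (angleSP (u 1) * Complex.I) * Complex.exp (-θ * Complex.I) := by
    rw [← Complex.exp_add]; push_cast; ring_nf
  rw [h, Complex.exp_mul_I]
  simp [rotCoord, polarInv]
  ring

theorem arg_rotCoord_polarInv {θ : ℝ} {u : EuclideanSpace ℝ (Fin 3)}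
    (hu : 0 < 1 + (u 2 ^ 2 - u 0 ^ 2) / 4)
    (hθ : angleSP (u 1) - θ ∈ Ioo (-Real.pi) Real.pi) :
    Complex.arg (rotCoord θ (polarInv u)) = angleSP (u 1) - θ := by
  rw [rotCoord_polarInv]
  exact Complex.arg_mul_cos_add_sin_mul_I (Real.sqrt_pos.2 hu) ⟨hθ.1, hθ.2.le⟩

theorem rotCoord_polarInv_mem {θ : ℝ} {u : EuclideanSpace ℝ (Fin 3)}
    (hu : 0 < 1 + (u 2 ^ 2 - u 0 ^ 2) / 4)
    (hθ : angleSP (u 1) - θ ∈ Ioo (-Real.pi) Real.pi) :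
    rotCoord θ (polarInv u) ∈ Complex.slitPlane := by
  rw [Complex.mem_slitPlane_iff_arg, arg_rotCoord_polarInv hu hθ]
  refine ⟨hθ.2.ne, ?_⟩
  rw [rotCoord_polarInv, ← Complex.exp_mul_I]
  exact mul_ne_zero (Complex.ofReal_ne_zero.2 (Real.sqrt_pos.2 hu).ne') (Complex.exp_ne_zero _)

open Classical in
/-- `polarMap` as an open partial homeomorphism of de Sitter space to `ℝ³`. -/
noncomputable def polarHomeo (θ : ℝ) :
    OpenPartialHomeomorph deSitter (EuclideanSpace ℝ (Fin 3)) where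
  toFun y := polarMap θ y
  -- The value in the other case is an arbitrary point of de Sitter space, never used on the target.
  invFun u := if h : 0 < 1 + (u 2 ^ 2 - u 0 ^ 2) / 4 then ⟨polarInv u, polarInv_mem h⟩
    else fSPExt vertexSP
  source := {y | rotCoord θ y ∈ Complex.slitPlane}
  target := {u | 0 < 1 + (u 2 ^ 2 - u 0 ^ 2) / 4 ∧ angleSP (u 1) - θ ∈ Ioo (-Real.pi) Real.pi}
  map_source' y hy := by
    have hy' := Complex.mem_slitPlane_iff_arg.1 hy
    have h1 : 0 < ‖rotCoord θ y‖ := norm_pos_iff.2 hy'.2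
    rw [norm_rotCoord_eq_sqrt θ y.2, Real.sqrt_pos] at h1
    refine ⟨h1, ?_⟩
    simp only [polarMap]
    simp only [Matrix.cons_val_one, Matrix.cons_val_zero, angleSP_symm,
      add_sub_cancel_left]
    exact ⟨Complex.neg_pi_lt_arg _, lt_of_le_of_ne (Complex.arg_le_pi _) hy'.1⟩
  map_target' u hu := by
    rw [dif_pos hu.1]
    exact rotCoord_polarInv_mem hu.1 hu.2
  left_inv' y hy := by
    have hy' := Complex.mem_slitPlane_iff_arg.1 hy
    have h1 : 0 < ‖rotCoord θ y‖ := norm_pos_iff.2 hy'.2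
    have h2 := norm_rotCoord_eq_sqrt θ y.2
    rw [h2, Real.sqrt_pos] at h1
    have h3 := norm_mul_cos_arg_rotCoord θ y
    have h4 := norm_mul_sin_arg_rotCoord θ y
    rw [h2] at h3 h4
    rw [dif_pos (show 0 < 1 + ((polarMap θ y) 2 ^ 2 - (polarMap θ y) 0 ^ 2) / 4 from h1)]
    ext i
    fin_cases i
    · simp [polarInv, polarMap]
    · simpa [polarInv, polarMap, angleSP_symm] using h3
    · simpa [polarInv, polarMap, angleSP_symm] using h4
    · simp [polarInv, polarMap]
  right_inv' u hu := by
    rw [dif_pos hu.1]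
    ext i
    fin_cases i
    · simp [polarMap, polarInv]; ring
    · have := arg_rotCoord_polarInv hu.1 hu.2
      simp [polarMap, this, symm_angleSP]
    · simp [polarMap, polarInv]; ring
  open_source := Complex.isOpen_slitPlane.preimage
    ((continuous_iff_continuousAt.2 fun y => (analyticAt_rotCoord θ y).continuousAt).comp
      continuous_subtype_val)
  open_target := by
    refine IsOpen.inter (isOpen_lt continuous_const (show Continuous
      fun u : EuclideanSpace ℝ (Fin 3) => 1 + (u 2 ^ 2 - u 0 ^ 2) / 4 by fun_prop)) ?_
    exact isOpen_Ioo.preimage ((continuous_angleSP.comp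
      (show Continuous fun u : EuclideanSpace ℝ (Fin 3) => u 1 by fun_prop)).sub continuous_const)
  continuousOn_toFun y hy :=
    ((analyticAt_polarMap hy).continuousAt.comp continuous_subtype_val.continuousAt
      ).continuousWithinAt
  continuousOn_invFun := by
    rw [Topology.IsInducing.subtypeVal.continuousOn_iff]
    intro u hu
    refine ((analyticAt_polarInv hu.1).continuousAt.continuousWithinAt).congr (fun w hw => ?_) ?_
    · simp [dif_pos hw.1]
    · simp [dif_pos hu.1]

theorem coe_polarHomeo_symm (θ : ℝ) {u : EuclideanSpace ℝ (Fin 3)}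
    (hu : 0 < 1 + (u 2 ^ 2 - u 0 ^ 2) / 4) :
    ((polarHomeo θ).symm u : EuclideanSpace ℝ (Fin 4)) = polarInv u := by
  classical
  change Subtype.val (dite _ _ _) = _
  rw [dif_pos hu]

theorem isAnalyticDiffeo_polarHomeo (θ : ℝ) : IsAnalyticDiffeo (polarHomeo θ) := by
  refine ⟨fun y hy => ⟨polarMap θ, analyticAt_polarMap hy, Eventually.of_forall fun z => rfl⟩,
    fun u hu => (analyticAt_polarInv hu.1).congr ?_⟩
  filter_upwards [(polarHomeo θ).open_target.mem_nhds hu] with w hw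
  exact (coe_polarHomeo_symm θ hw.1).symm

theorem fSPExt_eq_polarInv (p : XSP) : (fSPExt p : EuclideanSpace ℝ (Fin 4)) =
    polarInv !₂[p.1 0 - p.1 1, p.1 2, p.1 0 + p.1 1] := by
  have hp : p.1 0 * p.1 1 = p.1 2 ^ 2 / 4 := p.2
  have hr : ((p.1 0 + p.1 1) ^ 2 - (p.1 0 - p.1 1) ^ 2) / 4 = p.1 2 ^ 2 / 4 := by
    linear_combination hp
  ext i
  fin_cases i
  · simp [fSPExt, polarInv]; ring
  · simp [fSPExt, polarInv, hr, sqrt_mul_cos_angleSP]; ring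
  · simp [fSPExt, polarInv, hr, sqrt_mul_sin_angleSP]; ring
  · simp [fSPExt, polarInv]; ring

/-! ### The DC-immersion property -/

theorem isConeAnalyticOn_of_analyticOnNhd {m k : ℕ}
    {μ : doubleCone m → EuclideanSpace ℝ (Fin k)} {U : Set (doubleCone m)} (hU : IsOpen U)
    {g : EuclideanSpace ℝ (Fin (m + 1)) → EuclideanSpace ℝ (Fin k)}
    (hg : AnalyticOnNhd ℝ g univ) (h : ∀ x ∈ U, g x = μ x) : IsConeAnalyticOn μ U := by
  obtain ⟨Ω, hΩ, rfl⟩ := isOpen_induced_iff.1 hU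
  exact ⟨Ω, hΩ, rfl, g, hg.mono (subset_univ _), h⟩

theorem isDCCoordinate_restrOpen_chartSP (s : Set XSP) (hs : IsOpen s) :
    IsDCCoordinate (chartSP.toOpenPartialHomeomorph.restrOpen s hs) := by
  rintro e rfl
  constructor
  · refine isConeAnalyticOn_of_analyticOnNhd (OpenPartialHomeomorph.open_source _)
      (fun x _ => analyticAt_id) fun x _ => ?_
    exact congrArg Subtype.val (chartSP.apply_symm_apply x).symm
  · refine isConeAnalyticOn_of_analyticOnNhd (OpenPartialHomeomorph.open_source _)
      (fun x _ => analyticAt_id) fun x _ => ?_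
    exact congrArg Subtype.val (chartSP.apply_symm_apply x).symm

/-- The expression of `fSPExt` in the global chart, extended to `ℝ³`. -/
noncomputable def chartExprSP (a : EuclideanSpace ℝ (Fin 3)) : EuclideanSpace ℝ (Fin 4) :=
  !₂[a 2 / 2, (a 1 * Real.cos (a 1) - 2 * Real.sin (a 1)) / 2,
    (a 1 * Real.sin (a 1) + 2 * Real.cos (a 1)) / 2, a 0 / 2]

theorem analyticAt_chartExprSP (a : EuclideanSpace ℝ (Fin 3)) : AnalyticAt ℝ chartExprSP a := by
  have hc (i : Fin 3) : AnalyticAt ℝ (fun w : EuclideanSpace ℝ (Fin 3) => w i) a :=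
    (EuclideanSpace.proj i : EuclideanSpace ℝ (Fin 3) →L[ℝ] ℝ).analyticAt a
  have hcos : AnalyticAt ℝ (fun w : EuclideanSpace ℝ (Fin 3) => Real.cos (w 1)) a :=
    Real.analyticAt_cos.comp (hc 1)
  have hsin : AnalyticAt ℝ (fun w : EuclideanSpace ℝ (Fin 3) => Real.sin (w 1)) a :=
    Real.analyticAt_sin.comp (hc 1)
  refine analyticAt_toLp fun i => ?_
  fin_cases i
  · exact (hc 2).div analyticAt_const two_ne_zero
  · exact (((hc 1).mul hcos).sub (analyticAt_const.mul hsin)).div analyticAt_const two_ne_zero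
  · exact (((hc 1).mul hsin).add (analyticAt_const.mul hcos)).div analyticAt_const two_ne_zero
  · exact (hc 0).div analyticAt_const two_ne_zero

theorem continuous_chartExprSP : Continuous chartExprSP :=
  continuous_iff_continuousAt.2 fun a => (analyticAt_chartExprSP a).continuousAt

theorem fSPExt_eq_chartExprSP (p : XSP) :
    (fSPExt p : EuclideanSpace ℝ (Fin 4)) = chartExprSP (chartSP p) := by
  ext i
  fin_cases i <;> simp [fSPExt, chartExprSP, chartSP] <;> ring

theorem continuous_fSPExt : Continuous fSPExt := by
  refine continuous_induced_rng.2 ?_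
  exact (continuous_chartExprSP.comp (continuous_subtype_val.comp chartSP.continuous)).congr
    fun p => (fSPExt_eq_chartExprSP p).symm

theorem isDCAnalytic_fSPExt : IsDCAnalytic 2 fSPExt := by
  refine ⟨continuous_fSPExt, ?_⟩
  rintro e rfl
  refine isConeAnalyticOn_of_analyticOnNhd (OpenPartialHomeomorph.open_target _)
    (fun a _ => analyticAt_chartExprSP a) fun x _ => ?_
  rw [fSPExt_eq_chartExprSP]
  exact congrArg (fun c : doubleCone 2 => chartExprSP c) (chartSP.apply_symm_apply x).symm

theorem isDCRegularAt_fSPExt (p : XSP) : IsDCRegularAt 2 3 fSPExt p := by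
  -- Centring the argument at the angle of `p` puts the branch cut opposite to it; `s` is the set of
  -- points whose angle stays within `π`.
  set θ := angleSP (p.1 2)
  let s : Set XSP := {x | angleSP (x.1 2) - θ ∈ Ioo (-Real.pi) Real.pi}
  have hs : IsOpen s :=
    isOpen_Ioo.preimage ((continuous_angleSP.comp (by fun_prop)).sub continuous_const)
  have hu (x : XSP) : 0 < 1 + ((x.1 0 + x.1 1) ^ 2 - (x.1 0 - x.1 1) ^ 2) / 4 := by
    have hx : x.1 0 * x.1 1 = x.1 2 ^ 2 / 4 := x.2
    nlinarith [sq_nonneg (x.1 2)]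
  have htarget (x : XSP) (hx : x ∈ s) :
      (!₂[x.1 0 - x.1 1, x.1 2, x.1 0 + x.1 1] : EuclideanSpace ℝ (Fin 3)) ∈
        (polarHomeo θ).target := ⟨hu x, hx⟩
  have hf (x : XSP) : fSPExt x =
      (polarHomeo θ).symm !₂[x.1 0 - x.1 1, x.1 2, x.1 0 + x.1 1] := by
    refine Subtype.ext ?_
    rw [fSPExt_eq_polarInv, coe_polarHomeo_symm θ (hu x)]
  refine ⟨chartSP.toOpenPartialHomeomorph.restrOpen s hs, isDCCoordinate_restrOpen_chartSP s hs,
    ⟨mem_univ p, ?_⟩, polarHomeo θ, isAnalyticDiffeo_polarHomeo θ, ?_, ?_⟩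
  · change angleSP (p.1 2) - θ ∈ Ioo (-Real.pi) Real.pi
    rw [sub_self]
    exact ⟨by linarith [Real.pi_pos], Real.pi_pos⟩
  · intro x hx
    rw [hf]
    exact (polarHomeo θ).map_target (htarget x hx.2)
  · intro a ha
    have hx : chartSP.symm a ∈ s :=
      ((chartSP.toOpenPartialHomeomorph.restrOpen s hs).map_target ha).2
    change polarHomeo θ (fSPExt (chartSP.symm a)) = _
    rw [hf, (polarHomeo θ).right_inv (htarget _ hx)]
    ext i
    fin_cases i <;> simp [chartSP, padZero] <;> ring

theorem isDCImmersion_fSPExt : IsDCImmersion 2 3 fSPExt :=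
  ⟨by norm_num, isDCAnalytic_fSPExt, isDCRegularAt_fSPExt⟩

/-! ### The DC-points of `X_SP` -/

theorem chartSP_vertexSP : (chartSP vertexSP : EuclideanSpace ℝ (Fin 3)) = 0 := by
  ext i
  fin_cases i <;> simp [chartSP, vertexSP]

theorem vertexSP_mem_dcPoints : vertexSP ∈ dcPoints 2 XSP :=
  ⟨chartSP.toOpenPartialHomeomorph.restrOpen univ isOpen_univ,
    isDCCoordinate_restrOpen_chartSP univ isOpen_univ, ⟨mem_univ _, mem_univ _⟩, chartSP_vertexSP⟩

theorem coord_two_ne_zero_of_mem_doubleCone {c : doubleCone 2}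
    (hc : (c : EuclideanSpace ℝ (Fin 3)) ≠ 0) : c.1 2 ≠ 0 := by
  intro h
  have hc2 : c.1 0 ^ 2 + c.1 1 ^ 2 = c.1 2 ^ 2 := by
    have := c.2
    simpa [doubleCone, Fin.sum_univ_two, Fin.last] using this
  rw [h] at hc2
  have h0 : c.1 0 = 0 := by nlinarith [sq_nonneg (c.1 0), sq_nonneg (c.1 1)]
  have h1 : c.1 1 = 0 := by nlinarith [sq_nonneg (c.1 0), sq_nonneg (c.1 1)]
  apply hc
  ext i
  fin_cases i <;> simp [h, h0, h1]

/-- The vertex of the cone has no neighbourhood homeomorphic to an open subset of the plane. -/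
theorem apply_ne_zero_of_plane_homeomorph (e : OpenPartialHomeomorph ℂ (doubleCone 2)) {c : ℂ}
    (hc : c ∈ e.source) : (e c : EuclideanSpace ℝ (Fin 3)) ≠ 0 := by
  intro h0
  obtain ⟨r, hr, hball⟩ := Metric.isOpen_iff.1 e.open_source c hc
  -- Replacing the source by a ball identified with all of `ℂ` makes the punctured neighbourhood a
  -- punctured plane, which is connected.
  set β := OpenPartialHomeomorph.univBall (E := ℂ) c r
  have hβs : β.source = univ := OpenPartialHomeomorph.univBall_source c r
  have hβt : β.target = Metric.ball c r := OpenPartialHomeomorph.univBall_target c hr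
  have hβ0 : β 0 = c := OpenPartialHomeomorph.univBall_apply_zero c r
  have hβm (z : ℂ) : β z ∈ Metric.ball c r := hβt ▸ β.map_source (hβs ▸ mem_univ z)
  -- The third cone coordinate vanishes only at the vertex, so on the punctured plane its values
  -- form an interval avoiding `0`. Openness of the image on the cone will supply values of both
  -- signs, along the line `(δ, 0, δ)`.
  have hconn : IsPreconnected ((fun z => (e (β z) : EuclideanSpace ℝ (Fin 3)) 2) '' {0}ᶜ) := by
    refine (isConnected_compl_singleton_of_one_lt_rank (by simp) 0).isPreconnected.image _ ?_
    have h1 : ContinuousOn (fun z => e (β z)) univ :=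
      e.continuousOn.comp (OpenPartialHomeomorph.continuous_univBall c r).continuousOn
        fun z _ => hball (hβm z)
    have h2 : Continuous fun w : doubleCone 2 => (w : EuclideanSpace ℝ (Fin 3)) 2 := by fun_prop
    exact (h2.comp_continuousOn h1).mono (subset_univ _)
  have hzero : (0 : ℝ) ∉ (fun z => (e (β z) : EuclideanSpace ℝ (Fin 3)) 2) '' {0}ᶜ := by
    rintro ⟨z, hz, hz2⟩
    refine coord_two_ne_zero_of_mem_doubleCone (fun hz0 => hz ?_) hz2
    have h1 : β z = c := e.injOn (hball (hβm z)) hc (Subtype.ext (hz0.trans h0.symm))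
    exact β.injOn (hβs ▸ mem_univ z) (hβs ▸ mem_univ 0) (h1.trans hβ0.symm)
  have hW : IsOpen (e '' Metric.ball c r) :=
    e.isOpen_image_of_subset_source Metric.isOpen_ball hball
  have hcone (δ : ℝ) : (!₂[δ, 0, δ] : EuclideanSpace ℝ (Fin 3)) ∈ doubleCone 2 := by
    simp [doubleCone, Fin.sum_univ_two, Fin.last]
  let ℓ : ℝ → doubleCone 2 := fun δ => ⟨!₂[δ, 0, δ], hcone δ⟩
  have hℓ : Continuous ℓ := by fun_prop
  have hℓ0 : ℓ 0 ∈ e '' Metric.ball c r := by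
    refine ⟨c, Metric.mem_ball_self hr, Subtype.ext ?_⟩
    rw [h0]
    ext i
    fin_cases i <;> simp [ℓ]
  obtain ⟨δ, hδ, hδW⟩ := Metric.isOpen_iff.1 (hW.preimage hℓ) 0 hℓ0
  have hmem (t : ℝ) (ht : |t| < δ) (ht0 : t ≠ 0) :
      t ∈ (fun z => (e (β z) : EuclideanSpace ℝ (Fin 3)) 2) '' {0}ᶜ := by
    obtain ⟨w, hw, hwe⟩ := hδW (show t ∈ Metric.ball 0 δ by simpa using ht)
    have hβw : β (β.symm w) = w := β.right_inv (hβt ▸ hw)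
    refine ⟨β.symm w, fun hz => ht0 ?_, ?_⟩
    · rw [show β.symm w = 0 from hz, hβ0] at hβw
      rw [← hβw] at hwe
      have := congrArg (fun x : EuclideanSpace ℝ (Fin 3) => x 2)
        (h0.symm.trans (congrArg Subtype.val hwe))
      simpa [ℓ] using this.symm
    · simp only [hβw, hwe]
      simp [ℓ]
  have hδ2 : |δ / 2| < δ := by rw [abs_of_pos (by positivity)]; linarith
  exact hzero (hconn.ordConnected.out (hmem (-(δ / 2)) (by rwa [abs_neg]) (by linarith))
    (hmem (δ / 2) hδ2 (by positivity)) ⟨by linarith, by linarith⟩)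

theorem dcPoints_XSP : dcPoints 2 XSP = {vertexSP} := by
  refine Subset.antisymm ?_ (singleton_subset_iff.2 vertexSP_mem_dcPoints)
  rintro p ⟨ψ, -, hp, h0⟩
  by_contra hne
  obtain ⟨b, hb⟩ := exists_mem_paramSP_target hne
  have hs := (paramSP b).map_target hb
  have hr := (paramSP b).right_inv hb
  -- Composing `ψ` with a parametrization near `p` would map an open set of the plane onto a
  -- neighbourhood of the cone point. The analyticity of `ψ` plays no role.
  refine apply_ne_zero_of_plane_homeomorph
    (Complex.equivRealProdCLM.toHomeomorph.toOpenPartialHomeomorph.trans ((paramSP b).trans ψ))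
    (c := Complex.equivRealProdCLM.symm ((paramSP b).symm p)) ?_ ?_
  · simp [hs, hr, hp]
  · simpa [hr] using h0

/-! ### Connectedness and density -/

theorem connectedSpace_XSP : ConnectedSpace XSP := by
  have : ConnectedSpace (doubleCone 2) := connectedSpace_iff_univ.2 (isConnected_doubleCone 2)
  exact chartSP.symm.surjective.connectedSpace chartSP.symm.continuous

theorem mem_closure_of_curve {p : XSP} {c : ℝ → XSP} (hc : Continuous c) (h0 : c 0 = p)
    (h : ∀ δ ≠ 0, (c δ).1 2 ≠ 0) : p ∈ closure {x : XSP | x.1 2 ≠ 0} := by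
  have h1 : Tendsto c (𝓝[≠] 0) (𝓝 p) := h0 ▸ hc.continuousAt.continuousWithinAt
  exact mem_closure_of_tendsto h1 (eventually_mem_nhdsWithin.mono h)

/-- Each point with `t = 0` lies on a curve in `XSP` with parameter `t = δ`: the line `(δ/2, δ/2,
δ)` through the vertex, or a parabola with the non-zero one of `ξ, η` held fixed. -/
theorem dense_coord_two_ne_zero : Dense {x : XSP | x.1 2 ≠ 0} := by
  intro p
  by_cases ht : p.1 2 = 0
  swap
  · exact subset_closure ht
  have hp : p.1 0 * p.1 1 = 0 := by
    have : p.1 0 * p.1 1 = p.1 2 ^ 2 / 4 := p.2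
    rw [this, ht]; norm_num
  by_cases h0 : p.1 0 = 0
  · by_cases h1 : p.1 1 = 0
    · have h (δ : ℝ) : (!₂[δ / 2, δ / 2, δ] : EuclideanSpace ℝ (Fin 3)) ∈ XSP := by
        simp [XSP]; ring
      refine mem_closure_of_curve (c := fun δ => ⟨_, h δ⟩) (by fun_prop) ?_ (by simp)
      ext i; fin_cases i <;> simp [h0, h1, ht]
    · have h (δ : ℝ) : (!₂[δ ^ 2 / (4 * p.1 1), p.1 1, δ] : EuclideanSpace ℝ (Fin 3)) ∈ XSP := by
        simp [XSP]; field_simp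
      refine mem_closure_of_curve (c := fun δ => ⟨_, h δ⟩) (by fun_prop) ?_ (by simp)
      ext i; fin_cases i <;> simp [h0, ht]
  · have h1 : p.1 1 = 0 := (mul_eq_zero.1 hp).resolve_left h0
    have h (δ : ℝ) : (!₂[p.1 0, δ ^ 2 / (4 * p.1 0), δ] : EuclideanSpace ℝ (Fin 3)) ∈ XSP := by
      simp [XSP]; field_simp
    refine mem_closure_of_curve (c := fun δ => ⟨_, h δ⟩) (by fun_prop) ?_ (by simp)
    ext i; fin_cases i <;> simp [h1, ht]

theorem ne_vertexSP_of_coord_two {p : XSP} (hp : p.1 2 ≠ 0) : p ≠ vertexSP := by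
  rintro rfl
  exact hp (by simp [vertexSP])

theorem isSpaceLikeCMCOneDCImmersion_fSPExt : IsSpaceLikeCMCOneDCImmersion fSPExt := by
  refine ⟨connectedSpace_XSP, isDCImmersion_fSPExt, fun p hp => ?_, ?_⟩
  · rw [dcPoints_XSP] at hp
    by_cases ht : p.1 2 = 0
    · exact Or.inr (isLightLikeAt_fSPExt hp ht)
    · exact Or.inl (isSpaceLikeCMCOneAt_fSPExt ht)
  · refine dense_coord_two_ne_zero.mono fun p hp => ⟨?_, isSpaceLikeCMCOneAt_fSPExt hp⟩
    rw [dcPoints_XSP]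
    exact ne_vertexSP_of_coord_two hp

/-! ### Analytic extension -/

/-- The map `ℝ² → X_SP` through which the G-catenoid factors. -/
noncomputable def catenoidFactor (q : ℝ × ℝ) : XSP :=
  ⟨!₂[-q.2 / 2 * Real.exp q.1, -q.2 / 2 * Real.exp (-q.1), q.2], by
    have h : Real.exp q.1 * Real.exp (-q.1) = 1 := by rw [← Real.exp_add]; simp
    simp [XSP]
    linear_combination q.2 ^ 2 / 4 * h⟩

theorem fSP_eq_comp : fSP = fSPExt ∘ catenoidFactor := by
  funext q
  ext i
  fin_cases i <;>
    simp [fSP, fSPExt, catenoidFactor, boostSP, profileSP, Real.cosh_eq, Real.sinh_eq] <;> ring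

theorem analyticAt_chart_catenoidFactor (q : ℝ × ℝ) :
    AnalyticAt ℝ (fun r => (chartSP (catenoidFactor r) : EuclideanSpace ℝ (Fin 3))) q := by
  have hx : AnalyticAt ℝ (fun r : ℝ × ℝ => r.1) q := analyticAt_fst
  have ht : AnalyticAt ℝ (fun r : ℝ × ℝ => r.2) q := analyticAt_snd
  have he : AnalyticAt ℝ (fun r : ℝ × ℝ => Real.exp r.1) q := hx.rexp'
  have he' : AnalyticAt ℝ (fun r : ℝ × ℝ => Real.exp (-r.1)) q := hx.neg.rexp'
  refine analyticAt_toLp fun i => ?_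
  fin_cases i <;> simp [catenoidFactor] <;> fun_prop (disch := norm_num)

theorem isAnalyticExtension_fSPExt : IsAnalyticExtension 2 fSPExt fSP := by
  refine ⟨fun q _ => ?_, isDCAnalytic_fSPExt, ⟨catenoidFactor, ⟨?_, ?_⟩, fSP_eq_comp⟩, ?_, ?_⟩
  · simp only [fSP_eq_comp, Function.comp_apply, fSPExt_eq_chartExprSP]
    exact (analyticAt_chartExprSP _).comp (analyticAt_chart_catenoidFactor q)
  · rw [← chartSP.comp_continuous_iff, continuous_induced_rng]
    exact continuous_iff_continuousAt.2 fun q => (analyticAt_chart_catenoidFactor q).continuousAt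
  · rintro e rfl q -
    exact analyticAt_chart_catenoidFactor q
  · rw [fSP_eq_comp]
    exact range_comp_subset_range _ _
  · intro h
    -- The G-catenoid meets `t = 0` only at the image of the vertex, so it misses the light-like
    -- lines. The witness is `(1, 0, 0)`: `y₀ - y₃ = η = 0` forces `t = 0`, hence `ξ = 0`.
    obtain ⟨q, hq⟩ := h ⟨⟨!₂[1, 0, 0], by simp [XSP]⟩, rfl⟩
    have h' (i : Fin 4) := congrArg (fun y : deSitter => y.1 i) hq
    have h0 := h' 0
    have h3 := h' 3
    rw [fSP_eq_comp] at h0 h3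
    simp [fSPExt, catenoidFactor] at h0 h3
    have h4 : q.2 * Real.exp (-q.1) = 0 := by linarith
    have h6 : q.2 = 0 := (mul_eq_zero.1 h4).resolve_right (Real.exp_pos _).ne'
    rw [h6] at h0
    norm_num at h0

/-! ### Properness -/

theorem isClosed_deSitter : IsClosed deSitter := by
  unfold deSitter lorentz
  exact isClosed_eq (by fun_prop) continuous_const

/-- The squared norm of the image is `(ξ² + η²)/2 + t²/4 + 1`, so it controls all three coordinates.
Preimages of bounded sets are therefore bounded, which is the core of properness. -/
theorem norm_sq_le_of_fSPExt (p : XSP) : ‖(p : EuclideanSpace ℝ (Fin 3))‖ ^ 2 ≤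
    6 * ‖(fSPExt p : EuclideanSpace ℝ (Fin 4))‖ ^ 2 := by
  have hp : p.1 0 * p.1 1 = p.1 2 ^ 2 / 4 := p.2
  have hsc := Real.sin_sq_add_cos_sq (p.1 2)
  rw [EuclideanSpace.norm_sq_eq, EuclideanSpace.norm_sq_eq, Fin.sum_univ_three, Fin.sum_univ_four]
  simp only [Real.norm_eq_abs, sq_abs]
  simp [fSPExt]
  nlinarith [sq_nonneg (p.1 0), sq_nonneg (p.1 1), sq_nonneg (p.1 2)]

theorem isProperMap_fSPExt : IsProperMap fSPExt := by
  have := isClosed_deSitter.locallyCompactSpace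
  refine isProperMap_iff_isCompact_preimage.2 ⟨continuous_fSPExt, fun K hK => ?_⟩
  obtain ⟨R, hR⟩ := (hK.image continuous_subtype_val).isBounded.exists_norm_le
  rw [Subtype.isCompact_iff]
  refine Metric.isCompact_of_isClosed_isBounded ?_ ?_
  · exact isClosed_XSP.isClosedEmbedding_subtypeVal.isClosedMap _
      (hK.isClosed.preimage continuous_fSPExt)
  · refine isBounded_iff_forall_norm_le.2 ⟨√(6 * R ^ 2), ?_⟩
    rintro _ ⟨p, hp, rfl⟩
    refine Real.le_sqrt_of_sq_le ((norm_sq_le_of_fSPExt p).trans ?_)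
    have h1 := hR _ ⟨_, hp, rfl⟩
    gcongr

theorem mainTheorem10 :
    IsSpaceLikeCMCOneDCImmersion fSPExt ∧
    dcPoints 2 XSP = {vertexSP} ∧
    (∀ p : XSP, p.1 2 ≠ 0 → IsSpaceLikeCMCOneAt fSPExt p) ∧
    (∀ p : XSP, p ≠ vertexSP → p.1 2 = 0 → IsLightLikeAt fSPExt p) ∧
    IsAnalyticExtension 2 fSPExt fSP ∧
    IsProperMap fSPExt ∧
    AnalyticallyComplete deSitter (range fSPExt) :=
  ⟨isSpaceLikeCMCOneDCImmersion_fSPExt, dcPoints_XSP, fun _ => isSpaceLikeCMCOneAt_fSPExt,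
    fun _ => isLightLikeAt_fSPExt, isAnalyticExtension_fSPExt, isProperMap_fSPExt,
    analyticallyComplete_range_fSPExt⟩
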